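/- Let $q\in(-1,1)\setminus\{0\}$ and let $\theta$ be an irrational real number. Let $\mathrm{Pol}(\mathbb G_q^\theta)$ be the unital $*$-algebra over $\mathbb C$ generated by elements $\alpha,\gamma,u$ subject to the relations $$\gamma^*\gamma=\gamma\gamma^*,\quad q\gamma^*\alpha=\alpha\gamma^*,\quad q\gamma\alpha=\alpha\gamma,\quad \alpha^*\alpha+\gamma^*\gamma=1,\quad \alpha\alpha^*+q^2\gamma\gamma^*=1$$ (the relations of $\mathrm{Pol}(SU_q(2))$) together with $$u^*u=uu^*=1,\qquad u^*\gamma u=e^{2\pi i\theta}\gamma,\qquad u^*\alpha u=\alpha ,$$ with the Hopf $*$-algebra structure whose comultiplication is determined by $$\Delta(\alpha)=\alpha\otimes\alpha-q\gamma^*\otimes\gamma,\quad \Delta(\gamma)=\gamma\otimes\alpha+\alpha^*\otimes\gamma,\quad \Delta(u)=u\otimes u .$$ This is the Hopf $*$-algebra of a compact quantum group $\mathbb G_q^\theta=SU_q(2)\rtimes_{\rho_\theta}\mathbb Z$, the crossed product by the automorphism $\rho_\theta:\alpha\mapsto\alpha,\ \gamma\mapsto e^{2\pi i\theta}\gamma$.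 Then the discrete quantum group $\widehat{\mathbb G_q^\theta}$ dual to $\mathbb G_q^\theta$ 1. is $C^*$-unique: there is exactly one pre-$C^*$-norm on $\mathrm{Pol}(\mathbb G_q^\theta)$, i.e. exactly one submultiplicative complex vector space norm $\|\cdot\|$ with $\|x^*x\|=\|x\|^2$ for all $x$; 2. is not locally finite: it is not true that every finite set of equivalence classes of irreducible unitary representations of $\mathbb G_q^\theta$ generates a finite fusion ring. Here the fusion ring generated by a set $I$ is said to be finite if the smallest set of classes of irreducible unitary representations that contains $I$ and the trivial class and is stable under conjugation and under taking irreducible components of tensor products is finite. -/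

import Mathlib

open scoped TensorProduct ComplexConjugate Matrix

universe u

section Corepresentations

variable {A : Type*} [Ring A] [StarRing A] [HopfAlgebra ℂ A]
variable {ι κ l : Type*} [Fintype ι] [Fintype κ] [Fintype l]
  [DecidableEq ι] [DecidableEq κ] [DecidableEq l]

/-- A finite-dimensional unitary representation of a compact quantum group, as a unitary matrix
over the Hopf *-algebra with `Δ(u_ij) = ∑ₖ u_ik ⊗ u_kj`. -/
structure IsUnitaryCorep (U : Matrix ι ι A) : Prop where
  comul_apply : ∀ i j, Coalgebra.comul (R := ℂ) (U i j) = ∑ k, U i k ⊗ₜ[ℂ] U k j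
  conjTranspose_mul_self : Uᴴ * U = 1
  mul_conjTranspose_self : U * Uᴴ = 1

/-- The scalar matrix `T` intertwines `U` and `V`: `T U = V T`. -/
def IsIntertwiner (U : Matrix ι ι A) (V : Matrix κ κ A) (T : Matrix κ ι ℂ) : Prop :=
  T.map (algebraMap ℂ A) * U = V * T.map (algebraMap ℂ A)

/-- `U` and `V` are equivalent: there is an invertible intertwiner between them. -/
def CorepEquiv (U : Matrix ι ι A) (V : Matrix κ κ A) : Prop :=
  ∃ (T : Matrix κ ι ℂ) (S : Matrix ι κ ℂ), T * S = 1 ∧ S * T = 1 ∧ IsIntertwiner U V T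

/-- The tensor product of representations, with entries `u_ij v_kl`. -/
def tensorCorep (U : Matrix ι ι A) (V : Matrix κ κ A) : Matrix (ι × κ) (ι × κ) A :=
  Matrix.of fun p r => U p.1 r.1 * V p.2 r.2

theorem CorepEquiv.refl (U : Matrix ι ι A) : CorepEquiv U U :=
  ⟨1, 1, by simp, by simp, by simp [IsIntertwiner, Matrix.map_one]⟩

theorem CorepEquiv.symm {U : Matrix ι ι A} {V : Matrix κ κ A} (h : CorepEquiv U V) :
    CorepEquiv V U := by
  obtain ⟨T, S, h₁, h₂, h⟩ := h
  refine ⟨S, T, h₂, h₁, ?_⟩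
  have h₁' := congrArg (fun M => M.map (algebraMap ℂ A)) h₁
  have h₂' := congrArg (fun M => M.map (algebraMap ℂ A)) h₂
  simp only [Matrix.map_mul, map_zero, map_one, Matrix.map_one] at h₁' h₂'
  unfold IsIntertwiner at h ⊢
  calc S.map (algebraMap ℂ A) * V
      = S.map (algebraMap ℂ A) * (V * T.map (algebraMap ℂ A)) * S.map (algebraMap ℂ A) := by
        rw [Matrix.mul_assoc, Matrix.mul_assoc, h₁', Matrix.mul_one]
    _ = _ := by rw [← h, ← Matrix.mul_assoc, h₂', Matrix.one_mul]

theorem CorepEquiv.trans {U : Matrix ι ι A} {V : Matrix κ κ A} {W : Matrix l l A}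
    (h : CorepEquiv U V) (h' : CorepEquiv V W) : CorepEquiv U W := by
  obtain ⟨T, S, h₁, h₂, h⟩ := h
  obtain ⟨T', S', h₁', h₂', h'⟩ := h'
  refine ⟨T' * T, S * S', ?_, ?_, ?_⟩
  · rw [Matrix.mul_assoc, ← Matrix.mul_assoc T, h₁, Matrix.one_mul, h₁']
  · rw [Matrix.mul_assoc, ← Matrix.mul_assoc S', h₂', Matrix.one_mul, h₂]
  · unfold IsIntertwiner at h h' ⊢
    rw [Matrix.map_mul, Matrix.mul_assoc, h, ← Matrix.mul_assoc, h', Matrix.mul_assoc]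

/-- The trivial one-dimensional representation. -/
theorem isUnitaryCorep_one : IsUnitaryCorep (1 : Matrix (Fin 1) (Fin 1) A) where
  comul_apply i j := by
    obtain rfl : i = 0 := Subsingleton.elim _ _
    obtain rfl : j = 0 := Subsingleton.elim _ _
    simp [Algebra.TensorProduct.one_def]
  conjTranspose_mul_self := by simp
  mul_conjTranspose_self := by simp

theorem IsUnitaryCorep.tensor {U : Matrix ι ι A} {V : Matrix κ κ A} (hU : IsUnitaryCorep U)
    (hV : IsUnitaryCorep V) : IsUnitaryCorep (tensorCorep U V) where
  comul_apply i j := by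
    simp only [tensorCorep, Matrix.of_apply, Bialgebra.comul_mul, hU.comul_apply, hV.comul_apply,
      Finset.sum_mul_sum, Algebra.TensorProduct.tmul_mul_tmul, Fintype.sum_prod_type]
  conjTranspose_mul_self := by
    have hU₁ := fun i j => congrFun (congrFun hU.conjTranspose_mul_self i) j
    have hV₁ := fun i j => congrFun (congrFun hV.conjTranspose_mul_self i) j
    simp only [Matrix.mul_apply, Matrix.conjTranspose_apply, Matrix.one_apply] at hU₁ hV₁
    ext ⟨i, i'⟩ ⟨j, j'⟩
    simp only [Matrix.mul_apply, Matrix.conjTranspose_apply, tensorCorep, Matrix.of_apply, star_mul,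
      Fintype.sum_prod_type, Matrix.one_apply, Prod.mk.injEq]
    rw [Finset.sum_comm]
    have : ∀ y x, star (V y i') * star (U x i) * (U x j * V y j') =
        star (V y i') * (star (U x i) * U x j) * V y j' := fun y x => by simp only [mul_assoc]
    simp only [this, ← Finset.sum_mul, ← Finset.mul_sum, hU₁]
    by_cases h : i = j <;> simp [h, hV₁]
  mul_conjTranspose_self := by
    have hU₂ := fun i j => congrFun (congrFun hU.mul_conjTranspose_self i) j
    have hV₂ := fun i j => congrFun (congrFun hV.mul_conjTranspose_self i) j
    simp only [Matrix.mul_apply, Matrix.conjTranspose_apply, Matrix.one_apply] at hU₂ hV₂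
    ext ⟨i, i'⟩ ⟨j, j'⟩
    simp only [Matrix.mul_apply, Matrix.conjTranspose_apply, tensorCorep, Matrix.of_apply, star_mul,
      Fintype.sum_prod_type, Matrix.one_apply, Prod.mk.injEq]
    have : ∀ x y, U i x * V i' y * (star (V j' y) * star (U j x)) =
        U i x * (V i' y * star (V j' y)) * star (U j x) := fun y x => by simp only [mul_assoc]
    simp only [this, ← Finset.sum_mul, ← Finset.mul_sum, hV₂]
    by_cases h : i' = j' <;> simp [h, hU₂]

theorem IsUnitaryCorep.submatrix {U : Matrix ι ι A} (hU : IsUnitaryCorep U) (e : κ ≃ ι) :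
    IsUnitaryCorep (U.submatrix e e) where
  comul_apply i j := by
    simp only [Matrix.submatrix_apply, hU.comul_apply]
    exact (Equiv.sum_comp e (fun k => U (e i) k ⊗ₜ[ℂ] U k (e j))).symm
  conjTranspose_mul_self := by
    rw [Matrix.conjTranspose_submatrix, Matrix.submatrix_mul_equiv, hU.conjTranspose_mul_self]
    simp
  mul_conjTranspose_self := by
    rw [Matrix.conjTranspose_submatrix, Matrix.submatrix_mul_equiv, hU.mul_conjTranspose_self]
    simp

end Corepresentations

/-- A compact quantum group, given by its algebra `Pol` of polynomial functions: a Hopf *-algebra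
over `ℂ` that is spanned by the matrix coefficients of its finite-dimensional unitary
representations. -/
structure CompactQuantumGroup : Type (u + 1) where
  Pol : Type u
  [ring : Ring Pol]
  [starRing : StarRing Pol]
  [hopf : HopfAlgebra ℂ Pol]
  [starModule : StarModule ℂ Pol]
  comul_star : ∀ x : Pol,
    Coalgebra.comul (R := ℂ) (star x) = star (Coalgebra.comul (R := ℂ) x)
  span_coeff : Submodule.span ℂ {x : Pol | ∃ (n : ℕ) (U : Matrix (Fin n) (Fin n) Pol),
    IsUnitaryCorep U ∧ ∃ i j, U i j = x} = ⊤

namespace CompactQuantumGroup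

attribute [instance] ring starRing hopf starModule

variable (G : CompactQuantumGroup.{u})

/-- An irreducible unitary representation: a nonzero finite-dimensional one all of whose
self-intertwiners are scalar. -/
structure Irrep where
  dim : ℕ
  dim_pos : 0 < dim
  mat : Matrix (Fin dim) (Fin dim) G.Pol
  isUnitaryCorep : IsUnitaryCorep mat
  irreducible : ∀ T : Matrix (Fin dim) (Fin dim) ℂ, IsIntertwiner mat mat T → ∃ z : ℂ, T = z • 1

instance irrepSetoid : Setoid G.Irrep where
  r U V := CorepEquiv U.mat V.mat
  iseqv := ⟨fun _ => .refl _, .symm, .trans⟩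

/-- The set of equivalence classes of irreducible unitary representations. -/
def Irr : Type u := Quotient G.irrepSetoid

/-- The trivial representation. -/
def trivialIrrep : G.Irrep where
  dim := 1
  dim_pos := one_pos
  mat := 1
  isUnitaryCorep := isUnitaryCorep_one
  irreducible T _ := ⟨T 0 0, by ext i j; fin_cases i; fin_cases j; simp⟩

variable {G}

/-- The class of an irreducible representation. -/
def Irrep.cls (U : G.Irrep) : G.Irr := Quotient.mk _ U

/-- `y` is the class of the conjugates `(u_ij*)` of the representations of class `x`. -/
def IsConjugate (x y : G.Irr) : Prop :=
  ∃ U V : G.Irrep, U.cls = x ∧ V.cls = y ∧ CorepEquiv (U.mat.map star) V.mat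

/-- `z` occurs in the decomposition of the tensor product of `x` and `y`. -/
def IsComponent (x y z : G.Irr) : Prop :=
  ∃ U V W : G.Irrep, U.cls = x ∧ V.cls = y ∧ W.cls = z ∧
    ∃ T, T ≠ 0 ∧ IsIntertwiner W.mat (tensorCorep U.mat V.mat) T

/-- The members of the fusion subring generated by the set `I` of classes: the smallest set that
contains `I` and the trivial class and is stable under conjugation and under taking irreducible
components of tensor products. -/
inductive FusionGenerated (I : Set G.Irr) : G.Irr → Prop
  | of (x : G.Irr) (hx : x ∈ I) : FusionGenerated I x
  | trivial : FusionGenerated I G.trivialIrrep.cls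
  | conj (x y : G.Irr) (hx : FusionGenerated I x) (h : IsConjugate x y) : FusionGenerated I y
  | tensor (x y z : G.Irr) (hx : FusionGenerated I x) (hy : FusionGenerated I y)
      (h : IsComponent x y z) : FusionGenerated I z

end CompactQuantumGroup

/-- A discrete quantum group, given by its compact dual. -/
structure DiscreteQuantumGroup : Type (u + 1) where
  compactDual : CompactQuantumGroup.{u}

/-- The discrete quantum group dual to a compact quantum group. -/
def CompactQuantumGroup.dual (G : CompactQuantumGroup.{u}) : DiscreteQuantumGroup.{u} := ⟨G⟩

namespace DiscreteQuantumGroup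

/-- The quantum group ring `ℂ[Γ]`, that is `Pol` of the compact dual. -/
abbrev GroupRing (Γ : DiscreteQuantumGroup.{u}) : Type u := Γ.compactDual.Pol

/-- A pre-C*-norm: a submultiplicative complex algebra norm with the C*-identity. -/
def IsPreCStarNorm {A : Type*} [Ring A] [StarRing A] [Algebra ℂ A] (N : AlgebraNorm ℂ A) : Prop :=
  ∀ x : A, N (star x * x) = N x ^ 2

/-- The quantum group ring has a unique pre-C*-norm. -/
def IsCStarUnique (Γ : DiscreteQuantumGroup.{u}) : Prop :=
  ∃! N : AlgebraNorm ℂ Γ.GroupRing, IsPreCStarNorm N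

/-- Every finite set of classes of irreducible representations of the compact dual generates a
finite fusion ring. -/
def IsLocallyFinite (Γ : DiscreteQuantumGroup.{u}) : Prop :=
  ∀ I : Set Γ.compactDual.Irr, I.Finite →
    {x | CompactQuantumGroup.FusionGenerated I x}.Finite

end DiscreteQuantumGroup

namespace SUqTheta

/-- The six letters `a, aStar, c, cStar, u, uStar` stand for the generators `α, α*, γ, γ*` of
`Pol(SU_q(2))` and for the unitary `u, u*` implementing the action of `ℤ`. -/
inductive Gen : Type
  | a | aStar | c | cStar | u | uStar

/-- The complex number `exp (2 π i θ)`. -/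
noncomputable def phase (θ : ℝ) : ℂ := Complex.exp (2 * Real.pi * Complex.I * θ)

/-- The letter `g` as an element of the free algebra. -/
noncomputable abbrev X (g : Gen) : FreeAlgebra ℂ Gen := FreeAlgebra.ι ℂ g

open Gen in
/-- The defining relations of the algebraic crossed product of `Pol(SU_q(2))` by the automorphism
`α ↦ α, γ ↦ exp(2πiθ) γ`, each listed together with its adjoint: the relations of `SU_q(2)`, the
unitarity of `u`, and the covariance relations `u* γ u = exp(2πiθ) γ`, `u* α u = α`. -/
inductive Rel (q θ : ℝ) : FreeAlgebra ℂ Gen → FreeAlgebra ℂ Gen → Prop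
  | cc : Rel q θ (X cStar * X c) (X c * X cStar)
  | cStara : Rel q θ ((q : ℂ) • (X cStar * X a)) (X a * X cStar)
  | aStarc : Rel q θ ((q : ℂ) • (X aStar * X c)) (X c * X aStar)
  | ca : Rel q θ ((q : ℂ) • (X c * X a)) (X a * X c)
  | aStarcStar : Rel q θ ((q : ℂ) • (X aStar * X cStar)) (X cStar * X aStar)
  | aStara : Rel q θ (X aStar * X a + X cStar * X c) 1
  | aaStar : Rel q θ (X a * X aStar + (q : ℂ) ^ 2 • (X c * X cStar)) 1
  | uStaru : Rel q θ (X uStar * X u) 1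
  | uuStar : Rel q θ (X u * X uStar) 1
  | uStarcu : Rel q θ (X uStar * X c * X u) (phase θ • X c)
  | uStarcStaru : Rel q θ (X uStar * X cStar * X u) (conj (phase θ) • X cStar)
  | uStarau : Rel q θ (X uStar * X a * X u) (X a)
  | uStaraStaru : Rel q θ (X uStar * X aStar * X u) (X aStar)

/-- The *-algebra generated by `α, γ, u` subject to the relations above (the involution is defined
below). -/
def Pol (q θ : ℝ) : Type := RingQuot (Rel q θ)

noncomputable instance (q θ : ℝ) : Ring (Pol q θ) := inferInstanceAs (Ring (RingQuot (Rel q θ)))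
noncomputable instance instAlg (q θ : ℝ) : Algebra ℂ (Pol q θ) :=
  inferInstanceAs (Algebra ℂ (RingQuot (Rel q θ)))

variable {q θ : ℝ}

/-- The quotient map. -/
noncomputable def mk (q θ : ℝ) : FreeAlgebra ℂ Gen →ₐ[ℂ] Pol q θ := RingQuot.mkAlgHom ℂ (Rel q θ)

/-- The generators of `Pol q θ`. -/
noncomputable def gen (q θ : ℝ) (g : Gen) : Pol q θ := mk q θ (X g)

theorem mk_X (g : Gen) : mk q θ (X g) = gen q θ g := rfl

theorem mk_rel {x y : FreeAlgebra ℂ Gen} (h : Rel q θ x y) : mk q θ x = mk q θ y :=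
  RingQuot.mkAlgHom_rel ℂ h

/-- The universal property of `Pol q θ`. -/
noncomputable def lift {B : Type*} [Ring B] [Algebra ℂ B] (f : Gen → B)
    (h : ∀ x y, Rel q θ x y → FreeAlgebra.lift ℂ f x = FreeAlgebra.lift ℂ f y) :
    Pol q θ →ₐ[ℂ] B :=
  RingQuot.liftAlgHom ℂ ⟨FreeAlgebra.lift ℂ f, fun x y => h x y⟩

theorem lift_gen {B : Type*} [Ring B] [Algebra ℂ B] (f : Gen → B)
    (h : ∀ x y, Rel q θ x y → FreeAlgebra.lift ℂ f x = FreeAlgebra.lift ℂ f y) (g : Gen) :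
    lift f h (gen q θ g) = f g := by
  refine (RingQuot.liftAlgHom_mkAlgHom_apply ℂ _ _ _).trans ?_
  simp

theorem algHom_ext {B : Type*} [Semiring B] [Algebra ℂ B] {f g : Pol q θ →ₐ[ℂ] B}
    (h : ∀ x, f (gen q θ x) = g (gen q θ x)) : f = g := by
  refine RingQuot.ringQuot_ext' ℂ _ _ (FreeAlgebra.hom_ext (funext fun x => h x))

theorem induct {p : Pol q θ → Prop} (hs : ∀ r : ℂ, p (algebraMap ℂ _ r))
    (hg : ∀ g, p (gen q θ g)) (hm : ∀ x y, p x → p y → p (x * y))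
    (ha : ∀ x y, p x → p y → p (x + y)) (x : Pol q θ) : p x := by
  obtain ⟨x, rfl⟩ := RingQuot.mkAlgHom_surjective ℂ (Rel q θ) x
  change p (mk q θ x)
  induction x using FreeAlgebra.induction with
  | grade0 r => rw [AlgHom.commutes]; exact hs r
  | grade1 g => exact hg g
  | mul x y hx hy => rw [map_mul]; exact hm _ _ hx hy
  | add x y hx hy => rw [map_add]; exact ha _ _ hx hy

section
open Gen
theorem r_cc : gen q θ cStar * gen q θ c = gen q θ c * gen q θ cStar := by
  simpa [mk_X] using mk_rel (Rel.cc (q := q) (θ := θ))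
theorem r_acStar : gen q θ a * gen q θ cStar = (q : ℂ) • (gen q θ cStar * gen q θ a) := by
  simpa only [map_smul, map_mul, mk_X] using (mk_rel (Rel.cStara (q := q) (θ := θ))).symm
theorem r_caStar : gen q θ c * gen q θ aStar = (q : ℂ) • (gen q θ aStar * gen q θ c) := by
  simpa only [map_smul, map_mul, mk_X] using (mk_rel (Rel.aStarc (q := q) (θ := θ))).symm
theorem r_ac : gen q θ a * gen q θ c = (q : ℂ) • (gen q θ c * gen q θ a) := by
  simpa only [map_smul, map_mul, mk_X] using (mk_rel (Rel.ca (q := q) (θ := θ))).symm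
theorem r_cStaraStar : gen q θ cStar * gen q θ aStar = (q : ℂ) • (gen q θ aStar * gen q θ cStar) := by
  simpa only [map_smul, map_mul, mk_X] using (mk_rel (Rel.aStarcStar (q := q) (θ := θ))).symm
theorem r_aStara : gen q θ aStar * gen q θ a = 1 - gen q θ c * gen q θ cStar := by
  rw [eq_sub_iff_add_eq, ← r_cc]
  simpa [mk_X] using (mk_rel (Rel.aStara (q := q) (θ := θ)))
theorem r_aaStar : gen q θ a * gen q θ aStar = 1 - (q : ℂ) ^ 2 • (gen q θ c * gen q θ cStar) := by
  rw [eq_sub_iff_add_eq]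
  simpa [mk_X] using (mk_rel (Rel.aaStar (q := q) (θ := θ)))
theorem r_uStaru : gen q θ uStar * gen q θ u = 1 := by
  simpa [mk_X] using (mk_rel (Rel.uStaru (q := q) (θ := θ)))
theorem r_uuStar : gen q θ u * gen q θ uStar = 1 := by
  simpa [mk_X] using (mk_rel (Rel.uuStar (q := q) (θ := θ)))
theorem r_uStarcu : gen q θ uStar * gen q θ c * gen q θ u = phase θ • gen q θ c := by
  simpa [mk_X] using (mk_rel (Rel.uStarcu (q := q) (θ := θ)))
theorem r_uStarcStaru : gen q θ uStar * gen q θ cStar * gen q θ u = conj (phase θ) • gen q θ cStar := by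
  simpa [mk_X] using (mk_rel (Rel.uStarcStaru (q := q) (θ := θ)))
theorem r_uStarau : gen q θ uStar * gen q θ a * gen q θ u = gen q θ a := by
  simpa [mk_X] using (mk_rel (Rel.uStarau (q := q) (θ := θ)))
theorem r_uStaraStaru : gen q θ uStar * gen q θ aStar * gen q θ u = gen q θ aStar := by
  simpa [mk_X] using (mk_rel (Rel.uStaraStaru (q := q) (θ := θ)))
end

/-- The opposite algebra with complex conjugate scalars. -/
def ConjOp (A : Type) : Type := Aᵐᵒᵖ
instance (A : Type) [Ring A] : Ring (ConjOp A) := inferInstanceAs (Ring Aᵐᵒᵖ)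
noncomputable instance (A : Type) [Ring A] [Algebra ℂ A] : Algebra ℂ (ConjOp A) :=
  Algebra.compHom (Aᵐᵒᵖ) (starRingEnd ℂ)
def toConj {A : Type} (x : A) : ConjOp A := MulOpposite.op x
def ofConj {A : Type} (x : ConjOp A) : A := MulOpposite.unop x
theorem toConj_add {A : Type} [Ring A] (x y : A) : toConj x + toConj y = toConj (x + y) := rfl
theorem toConj_mul {A : Type} [Ring A] (x y : A) : toConj x * toConj y = toConj (y * x) := rfl
theorem toConj_one {A : Type} [Ring A] : (1 : ConjOp A) = toConj (1 : A) := rfl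
theorem toConj_smul {A : Type} [Ring A] [Algebra ℂ A] (r : ℂ) (x : A) :
    r • toConj x = toConj (conj r • x) := rfl
theorem algebraMap_conj {A : Type} [Ring A] [Algebra ℂ A] (r : ℂ) :
    algebraMap ℂ (ConjOp A) r = toConj (algebraMap ℂ A (conj r)) := rfl

/-- The adjoint on letters. -/
def adj : Gen → Gen
  | .a => .aStar | .aStar => .a | .c => .cStar | .cStar => .c | .u => .uStar | .uStar => .u

/-- The involution, as a homomorphism to the conjugate opposite algebra. -/
noncomputable def starHom (q θ : ℝ) : Pol q θ →ₐ[ℂ] ConjOp (Pol q θ) :=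
  lift (fun g => toConj (gen q θ (adj g))) (by
    rintro _ _ (_ | _ | _ | _ | _ | _ | _ | _ | _ | _ | _ | _ | _) <;>
    simp only [map_mul, map_add, map_smul, map_one, FreeAlgebra.lift_ι_apply, toConj_add,
      toConj_mul, toConj_one, toConj_smul, adj, ← mul_assoc, map_pow, Complex.conj_ofReal,
      Complex.conj_conj, r_cc, r_acStar, r_caStar, r_ac, r_cStaraStar, r_aStara, r_aaStar, r_uStaru, r_uuStar, r_uStarcu,
      r_uStarcStaru, r_uStarau, r_uStaraStaru, sub_add_cancel])

noncomputable instance : StarRing (Pol q θ) where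
  star x := ofConj (starHom q θ x)
  star_involutive x := by
    have h0 : ∀ x y : Pol q θ, ofConj (starHom q θ (x * y)) =
      ofConj (starHom q θ y) * ofConj (starHom q θ x) := fun x y => by rw [map_mul]; rfl
    have h1 : ∀ x y : Pol q θ, ofConj (starHom q θ (x + y)) =
      ofConj (starHom q θ x) + ofConj (starHom q θ y) := fun x y => by rw [map_add]; rfl
    have h2 : ∀ r : ℂ, ofConj (starHom q θ (algebraMap ℂ _ r)) = algebraMap ℂ _ (conj r) :=
      fun r => by rw [AlgHom.commutes]; rfl
    have h3 : ∀ g, ofConj (starHom q θ (gen q θ g)) = gen q θ (adj g) :=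
      fun g => by rw [starHom, lift_gen]; rfl
    beta_reduce
    induction x using induct with
    | hs r => simp only [h2, Complex.conj_conj]
    | hg g => rw [h3, h3]; cases g <;> rfl
    | hm x y hx hy => rw [h0, h0, hx, hy]
    | ha x y hx hy => rw [h1, h1, hx, hy]
  star_mul x y := by rw [map_mul]; rfl
  star_add x y := by rw [map_add]; rfl

theorem star_def (x : Pol q θ) : star x = ofConj (starHom q θ x) := rfl

theorem star_gen (g : Gen) : star (gen q θ g) = gen q θ (adj g) := by
  rw [star_def, starHom, lift_gen]; rfl

instance : StarModule ℂ (Pol q θ) where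
  star_smul r x := by rw [star_def, map_smul]; rfl


theorem phase_conj : conj (phase θ) = (phase θ)⁻¹ := by
  rw [phase, ← Complex.exp_conj, ← Complex.exp_neg]
  congr 1
  simp [Complex.conj_ofNat]

theorem phase_ne : phase θ ≠ 0 := Complex.exp_ne_zero _

theorem phase_mul₁ {M : Type*} [AddCommMonoid M] [Module ℂ M] (x : M) :
    phase θ • conj (phase θ) • x = x := by
  rw [phase_conj, smul_inv_smul₀ phase_ne]

theorem phase_mul₂ {M : Type*} [AddCommMonoid M] [Module ℂ M] (x : M) :
    conj (phase θ) • phase θ • x = x := by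
  rw [phase_conj, inv_smul_smul₀ phase_ne]

open Gen in
/-- The comultiplication on generators: `Δ(α) = α ⊗ α - q γ* ⊗ γ`, `Δ(γ) = γ ⊗ α + α* ⊗ γ`,
`Δ(u) = u ⊗ u`, and the adjoint formulas. -/
noncomputable def comulGen (q θ : ℝ) : Gen → Pol q θ ⊗[ℂ] Pol q θ
  | a => gen q θ a ⊗ₜ gen q θ a - (q : ℂ) • (gen q θ cStar ⊗ₜ gen q θ c)
  | aStar => gen q θ aStar ⊗ₜ gen q θ aStar - (q : ℂ) • (gen q θ c ⊗ₜ gen q θ cStar)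
  | c => gen q θ c ⊗ₜ gen q θ a + gen q θ aStar ⊗ₜ gen q θ c
  | cStar => gen q θ cStar ⊗ₜ gen q θ aStar + gen q θ a ⊗ₜ gen q θ cStar
  | u => gen q θ u ⊗ₜ gen q θ u
  | uStar => gen q θ uStar ⊗ₜ gen q θ uStar

/-- The comultiplication. -/
noncomputable def comulHom (q θ : ℝ) : Pol q θ →ₐ[ℂ] Pol q θ ⊗[ℂ] Pol q θ :=
  lift (comulGen q θ) (by
    rintro _ _ (_ | _ | _ | _ | _ | _ | _ | _ | _ | _ | _ | _ | _) <;>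
    simp only [map_mul, map_add, map_smul, map_one, FreeAlgebra.lift_ι_apply, comulGen, add_mul,
      mul_add, sub_mul, mul_sub, smul_mul_assoc, mul_smul_comm,
      Algebra.TensorProduct.tmul_mul_tmul, Algebra.TensorProduct.one_def,
      r_cc, r_acStar, r_caStar, r_ac, r_cStaraStar, r_aStara, r_aaStar, r_uStaru, r_uuStar, r_uStarcu,
      r_uStarcStaru, r_uStarau, r_uStaraStaru, TensorProduct.tmul_smul, ← TensorProduct.smul_tmul',
      TensorProduct.sub_tmul, TensorProduct.tmul_sub, phase_mul₁, phase_mul₂] <;> try module)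

open Gen in
/-- The counit on generators. -/
noncomputable def counitGen : Gen → ℂ
  | a => 1 | aStar => 1 | c => 0 | cStar => 0 | u => 1 | uStar => 1

/-- The counit. -/
noncomputable def counitHom (q θ : ℝ) : Pol q θ →ₐ[ℂ] ℂ :=
  lift counitGen (by
    rintro _ _ (_ | _ | _ | _ | _ | _ | _ | _ | _ | _ | _ | _ | _) <;> simp [counitGen, -Complex.coe_smul])

open Gen in
/-- The antipode on generators. -/
noncomputable def antipodeGen (q θ : ℝ) : Gen → (Pol q θ)ᵐᵒᵖ
  | a => .op (gen q θ aStar)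
  | aStar => .op (gen q θ a)
  | c => .op (-(q : ℂ) • gen q θ c)
  | cStar => .op (-(q : ℂ)⁻¹ • gen q θ cStar)
  | u => .op (gen q θ uStar)
  | uStar => .op (gen q θ u)

/-- The antipode, as a homomorphism to the opposite algebra. -/
noncomputable def antipodeHom (hq : q ≠ 0) : Pol q θ →ₐ[ℂ] (Pol q θ)ᵐᵒᵖ :=
  lift (antipodeGen q θ) (by
    have hq' : (q : ℂ) ≠ 0 := by exact_mod_cast hq
    rintro _ _ (_ | _ | _ | _ | _ | _ | _ | _ | _ | _ | _ | _ | _) <;>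
    simp only [map_mul, map_add, map_smul, map_one, FreeAlgebra.lift_ι_apply, antipodeGen,
      ← MulOpposite.op_mul, ← MulOpposite.op_add, ← MulOpposite.op_smul, ← MulOpposite.op_one,
      smul_mul_assoc, mul_smul_comm, ← mul_assoc,
      r_cc, r_acStar, r_caStar, r_ac, r_cStaraStar, r_aStara, r_aaStar, r_uStaru, r_uuStar,
      r_uStarcu, r_uStarcStaru, r_uStarau, r_uStaraStaru] <;> congr 1 <;> match_scalars <;>
      (try field_simp) <;> (try ring))

noncomputable instance instBialgebra (q θ : ℝ) : Bialgebra ℂ (Pol q θ) :=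
  Bialgebra.ofAlgHom (comulHom q θ) (counitHom q θ)
    (algHom_ext fun g => by
      cases g <;> simp [comulHom, lift_gen, comulGen, -Complex.coe_smul,
        TensorProduct.tmul_sub, TensorProduct.sub_tmul, TensorProduct.tmul_add,
        TensorProduct.add_tmul, ← TensorProduct.smul_tmul'] <;> module)
    (algHom_ext fun g => by
      cases g <;> simp [comulHom, counitHom, lift_gen, comulGen, counitGen, -Complex.coe_smul])
    (algHom_ext fun g => by
      cases g <;> simp [comulHom, counitHom, lift_gen, comulGen, counitGen, -Complex.coe_smul])

theorem comul_gen (g : Gen) : Coalgebra.comul (R := ℂ) (gen q θ g) = comulGen q θ g :=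
  lift_gen _ _ _

theorem counit_gen (g : Gen) : Coalgebra.counit (R := ℂ) (gen q θ g) = counitGen g :=
  lift_gen _ _ _

/-- The antipode as a linear map. -/
noncomputable def antipodeLin (hq : q ≠ 0) : Pol q θ →ₗ[ℂ] Pol q θ :=
  (MulOpposite.opLinearEquiv ℂ).symm.toLinearMap ∘ₗ (antipodeHom hq).toLinearMap

theorem antipodeLin_gen (hq : q ≠ 0) (g : Gen) :
    antipodeLin hq (gen q θ g) = (antipodeGen q θ g).unop := by
  simp [antipodeLin, antipodeHom, lift_gen]

theorem antipodeLin_mul (hq : q ≠ 0) (x y : Pol q θ) :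
    antipodeLin hq (x * y) = antipodeLin hq y * antipodeLin hq x := by
  simp [antipodeLin]

theorem antipodeLin_one (hq : q ≠ 0) :
    antipodeLin hq (1 : Pol q θ) = 1 := by
  simp [antipodeLin]

theorem antipode_left (hq : q ≠ 0) :
    LinearMap.mul' ℂ (Pol q θ) ∘ₗ (antipodeLin hq).rTensor (Pol q θ) ∘ₗ Coalgebra.comul =
      Algebra.linearMap ℂ (Pol q θ) ∘ₗ Coalgebra.counit := by
  have hq' : (q : ℂ) ≠ 0 := by exact_mod_cast hq
  have key : ∀ (y : Pol q θ) (c : ℂ) (t s : Pol q θ ⊗[ℂ] Pol q θ),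
      LinearMap.mul' ℂ (Pol q θ) ((antipodeLin hq).rTensor (Pol q θ) t) = c • 1 →
      LinearMap.mul' ℂ (Pol q θ) ((antipodeLin hq).rTensor (Pol q θ) (t * s)) =
        c • LinearMap.mul' ℂ (Pol q θ) ((antipodeLin hq).rTensor (Pol q θ) s) := by
    intro y c t s ht
    induction s with
    | zero => simp
    | add s₁ s₂ h₁ h₂ => rw [mul_add, map_add, map_add, h₁, h₂, ← smul_add, ← map_add, ← map_add]
    | tmul x y =>
      have : ∀ t : Pol q θ ⊗[ℂ] Pol q θ,
          LinearMap.mul' ℂ (Pol q θ) ((antipodeLin hq).rTensor (Pol q θ) (t * x ⊗ₜ y)) =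
          antipodeLin hq x *
            LinearMap.mul' ℂ (Pol q θ) ((antipodeLin hq).rTensor (Pol q θ) t) * y := by
        intro t
        induction t with
        | zero => simp
        | add s₁ s₂ h₁ h₂ => rw [add_mul, map_add, map_add, h₁, h₂, map_add, map_add, mul_add, add_mul]
        | tmul x y => simp [antipodeLin_mul, mul_assoc]
      rw [this, ht]
      simp
  ext x
  simp only [LinearMap.comp_apply, Algebra.linearMap_apply, Algebra.algebraMap_eq_smul_one]
  induction x using induct with
  | hs r => simp [Algebra.algebraMap_eq_smul_one, Algebra.TensorProduct.one_def, antipodeLin_one]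
  | ha x y hx hy => simp only [map_add, hx, hy, add_smul]
  | hm x y hx hy =>
    rw [Bialgebra.comul_mul, key x _ _ _ hx, hy, Bialgebra.counit_mul, smul_smul]
  | hg g =>
    rw [comul_gen, counit_gen]
    cases g <;>
      simp [comulGen, counitGen, antipodeLin_gen, antipodeGen, -Complex.coe_smul, r_cc, r_acStar,
        r_caStar, r_ac, r_cStaraStar, r_aStara, r_aaStar, r_uStaru, r_uuStar] <;>
      match_scalars <;> (try field_simp) <;> (try ring)

theorem antipode_right (hq : q ≠ 0) :
    LinearMap.mul' ℂ (Pol q θ) ∘ₗ (antipodeLin hq).lTensor (Pol q θ) ∘ₗ Coalgebra.comul =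
      Algebra.linearMap ℂ (Pol q θ) ∘ₗ Coalgebra.counit := by
  have hq' : (q : ℂ) ≠ 0 := by exact_mod_cast hq
  have key : ∀ (y : Pol q θ) (c : ℂ) (t s : Pol q θ ⊗[ℂ] Pol q θ),
      LinearMap.mul' ℂ (Pol q θ) ((antipodeLin hq).lTensor (Pol q θ) s) = c • 1 →
      LinearMap.mul' ℂ (Pol q θ) ((antipodeLin hq).lTensor (Pol q θ) (t * s)) =
        c • LinearMap.mul' ℂ (Pol q θ) ((antipodeLin hq).lTensor (Pol q θ) t) := by
    intro y c t s ht
    induction t with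
    | zero => simp
    | add s₁ s₂ h₁ h₂ => rw [add_mul, map_add, map_add, h₁, h₂, ← smul_add, ← map_add, ← map_add]
    | tmul x y =>
      have : ∀ t : Pol q θ ⊗[ℂ] Pol q θ,
          LinearMap.mul' ℂ (Pol q θ) ((antipodeLin hq).lTensor (Pol q θ) (x ⊗ₜ y * t)) =
          x * LinearMap.mul' ℂ (Pol q θ) ((antipodeLin hq).lTensor (Pol q θ) t) *
            antipodeLin hq y := by
        intro t
        induction t with
        | zero => simp
        | add s₁ s₂ h₁ h₂ => rw [mul_add, map_add, map_add, h₁, h₂, map_add, map_add, mul_add, add_mul]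
        | tmul x y => simp [antipodeLin_mul, mul_assoc]
      rw [this, ht]
      simp
  ext x
  simp only [LinearMap.comp_apply, Algebra.linearMap_apply, Algebra.algebraMap_eq_smul_one]
  induction x using induct with
  | hs r => simp [Algebra.algebraMap_eq_smul_one, Algebra.TensorProduct.one_def, antipodeLin_one]
  | ha x y hx hy => simp only [map_add, hx, hy, add_smul]
  | hm x y hx hy =>
    rw [Bialgebra.comul_mul, key x _ _ _ hy, hx, Bialgebra.counit_mul, smul_smul, mul_comm]
  | hg g =>
    rw [comul_gen, counit_gen]
    cases g <;>
      simp [comulGen, counitGen, antipodeLin_gen, antipodeGen, -Complex.coe_smul, r_cc, r_acStar,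
        r_caStar, r_ac, r_cStaraStar, r_aStara, r_aaStar, r_uStaru, r_uuStar] <;>
      match_scalars <;> (try field_simp) <;> (try ring)

/-- The Hopf algebra structure of `Pol q θ`. -/
noncomputable abbrev hopf (θ : ℝ) (hq : q ≠ 0) : HopfAlgebra ℂ (Pol q θ) where
  antipode := antipodeLin hq
  mul_antipode_rTensor_comul := antipode_left hq
  mul_antipode_lTensor_comul := antipode_right hq

theorem star_mul_tensor (s t : Pol q θ ⊗[ℂ] Pol q θ) : star (s * t) = star t * star s := by
  induction s with
  | zero => simp
  | add s₁ s₂ h₁ h₂ => rw [add_mul, star_add, h₁, h₂, star_add, mul_add]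
  | tmul x y =>
    induction t with
    | zero => simp
    | add s₁ s₂ h₁ h₂ => rw [mul_add, star_add, h₁, h₂, star_add, add_mul]
    | tmul x y => simp

theorem comul_star (x : Pol q θ) :
    Coalgebra.comul (R := ℂ) (star x) = star (Coalgebra.comul (R := ℂ) x) := by
  induction x using induct with
  | hs r =>
    simp only [Algebra.algebraMap_eq_smul_one, star_smul, star_one, map_smul, Bialgebra.comul_one,
      Algebra.TensorProduct.one_def, TensorProduct.star_tmul]
  | ha x y hx hy => simp only [star_add, map_add, hx, hy]
  | hm x y hx hy => rw [star_mul, Bialgebra.comul_mul, Bialgebra.comul_mul, hx, hy, star_mul_tensor]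
  | hg g =>
    rw [star_gen, comul_gen, comul_gen]
    cases g <;> simp [comulGen, adj, star_gen, -Complex.coe_smul]


open Gen in
/-- The fundamental representation of `SU_q(2)`. -/
noncomputable def fund (q θ : ℝ) : Matrix (Fin 2) (Fin 2) (Pol q θ) :=
  !![gen q θ a, -(q : ℂ) • gen q θ cStar; gen q θ c, gen q θ aStar]

theorem fund_corep (hq : q ≠ 0) : letI := hopf θ hq; IsUnitaryCorep (fund q θ) := by
  let := hopf θ hq
  refine ⟨?_, ?_, ?_⟩
  · intro i j
    fin_cases i <;> fin_cases j <;>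
      simp only [fund, Fin.zero_eta, Fin.mk_one, Matrix.of_apply, Matrix.cons_val', Matrix.cons_val_zero,
        Matrix.cons_val_one, Matrix.cons_val_fin_one, Fin.sum_univ_two, map_smul, comul_gen,
        comulGen, neg_smul, map_neg, TensorProduct.neg_tmul, TensorProduct.tmul_neg,
        TensorProduct.tmul_smul, ← TensorProduct.smul_tmul'] <;> try module
  all_goals
    ext i j; fin_cases i <;> fin_cases j <;>
      simp [fund, Matrix.mul_apply, Fin.sum_univ_two, star_gen, adj, -Complex.coe_smul,
        r_cc, r_acStar, r_caStar, r_ac, r_cStaraStar, r_aStara, r_aaStar] <;> try module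

theorem u_corep (hq : q ≠ 0) (g : Gen) (hg : g = .u ∨ g = .uStar) :
    letI := hopf θ hq; IsUnitaryCorep (Matrix.of fun _ _ : Fin 1 => gen q θ g) := by
  let := hopf θ hq
  refine ⟨fun i j => ?_, ?_, ?_⟩
  · rcases hg with rfl | rfl <;> simp [comul_gen, comulGen]
  all_goals
    rcases hg with rfl | rfl <;> ext i j <;> fin_cases i <;> fin_cases j <;>
      simp [Matrix.mul_apply, star_gen, adj, r_uStaru, r_uuStar]

theorem span_coeff (hq : q ≠ 0) : letI := hopf θ hq
    Submodule.span ℂ {x : Pol q θ | ∃ (n : ℕ) (U : Matrix (Fin n) (Fin n) (Pol q θ)),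
      IsUnitaryCorep U ∧ ∃ i j, U i j = x} = ⊤ := by
  let := hopf θ hq
  have hq' : (q : ℂ) ≠ 0 := by exact_mod_cast hq
  rw [Submodule.eq_top_iff']
  intro x
  induction x using induct with
  | hs r =>
    rw [Algebra.algebraMap_eq_smul_one]
    exact Submodule.smul_mem _ _ (Submodule.subset_span ⟨1, 1, isUnitaryCorep_one, 0, 0, rfl⟩)
  | ha x y hx hy => exact Submodule.add_mem _ hx hy
  | hm x y hx hy =>
    have h := Submodule.mul_mem_mul hx hy
    rw [Submodule.span_mul_span] at h
    refine Submodule.span_mono ?_ h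
    rintro _ ⟨_, ⟨n, U, hU, i, j, rfl⟩, _, ⟨m, V, hV, k, l, rfl⟩, rfl⟩
    refine ⟨n * m, _, (hU.tensor hV).submatrix finProdFinEquiv.symm,
      finProdFinEquiv (i, k), finProdFinEquiv (j, l), ?_⟩
    simp [tensorCorep]
  | hg g =>
    cases g with
    | a => exact Submodule.subset_span ⟨2, _, fund_corep hq, 0, 0, rfl⟩
    | aStar => exact Submodule.subset_span ⟨2, _, fund_corep hq, 1, 1, rfl⟩
    | c => exact Submodule.subset_span ⟨2, _, fund_corep hq, 1, 0, rfl⟩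
    | cStar =>
      have h : gen q θ .cStar = (-(q : ℂ))⁻¹ • fund q θ 0 1 := by
        simp [fund, -Complex.coe_smul, hq']
      rw [h]
      exact Submodule.smul_mem _ _ (Submodule.subset_span ⟨2, _, fund_corep hq, 0, 1, rfl⟩)
    | u => exact Submodule.subset_span ⟨1, _, u_corep hq _ (.inl rfl), 0, 0, rfl⟩
    | uStar => exact Submodule.subset_span ⟨1, _, u_corep hq _ (.inr rfl), 0, 0, rfl⟩

end SUqTheta

/-- The crossed product quantum group `SU_q(2) ⋊ ℤ`, where `ℤ` acts through `α ↦ α`,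
`γ ↦ exp(2πiθ) γ`. -/
noncomputable def SUqCrossedZ (q θ : ℝ) (hq : q ≠ 0) : CompactQuantumGroup.{0} :=
  letI := SUqTheta.hopf θ hq
  { Pol := SUqTheta.Pol q θ
    comul_star := SUqTheta.comul_star
    span_coeff := SUqTheta.span_coeff hq }

/-! Write t = γγ*. The algebra is spanned by homogeneous pieces of degree (i, l, m) in α, γ, u, each
piece being one monomial times the polynomials in t (`exists_homog_decomposition`). For x
homogeneous, x*x is a polynomial P in t (`exists_modulus_of_mem_homog`).

Let π be a *-homomorphism to a C*-algebra with π(γ) ≠ 0. The relations α*α = 1 - t and αα* = 1 - q²t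
force the spectrum of π(t) to be {0} ∪ {q^(2n)} (`spectrum_eq_of_quantumDisc`), so ‖π(x)‖² = sup
|P(q^(2n))| does not depend on π when x is homogeneous.

In every such π each homogeneous component is bounded in norm by the whole element
(`norm_map_component_le`). Conjugation by u multiplies by a power of exp(2πiθ) that determines l,
since θ is irrational; averaging isolates l. After cutting down by an element p supported on one
eigenvalue of t, components with different i have orthogonal ranges. Conjugation by γ then plays the
part of a further unitary and isolates m, again by irrationality. No conditional expectation or Haar
state is needed.

An element of word length d has at most (2d+1)³ components, so two such norms differ on it by at
most that factor. Applied to the powers (x*x)^(2^k), on which C*-norms are multiplicative, the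
polynomial factor disappears in the limit and the norms coincide (`norm_map_le`). The component
bound also gives faithfulness, because a polynomial vanishing at all q^(2n) is zero. Every
pre-C*-norm comes from the C*-completion, where γ survives; existence comes from the standard
representation on ℓ²(ℕ × ℤ).

Local finiteness fails because the powers of u are infinitely many inequivalent one-dimensional
representations, all generated by u. -/

open Polynomial

/-! ### Integer powers built from a pair of elements -/

section AltPow

variable {A : Type*} [Monoid A]

/-- The powers of `x` with nonnegative exponent, together with the powers of `y` as powers of `x`
with negative exponent. -/
def altPow (x y : A) : ℤ → A
  | .ofNat n => x ^ n
  | .negSucc n => y ^ (n + 1)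

theorem altPow_natCast (x y : A) (n : ℕ) : altPow x y n = x ^ n := rfl

theorem altPow_zero (x y : A) : altPow x y 0 = 1 := (altPow_natCast x y 0).trans (pow_zero x)

theorem altPow_neg_natCast (x y : A) (n : ℕ) : altPow x y (-n) = y ^ n := by
  cases n with
  | zero => rw [pow_zero, Nat.cast_zero, neg_zero, altPow_zero]
  | succ n => rfl

theorem altPow_neg (x y : A) (n : ℤ) : altPow x y (-n) = altPow y x n := by
  obtain ⟨k, rfl | rfl⟩ := n.eq_nat_or_neg
  · rw [altPow_neg_natCast, altPow_natCast]
  · rw [altPow_neg_natCast, neg_neg, altPow_natCast]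

end AltPow

/-! ### Commutation up to a scalar, and polynomial moduli -/

section SkewCommutation

variable {A : Type*} [Ring A] [Algebra ℂ A]

/-- `s` and `x` commute up to the scalar `κ`. -/
def SkewComm (s x : A) (κ : ℂ) : Prop := s * x = κ • (x * s)

theorem SkewComm.one (s : A) : SkewComm s 1 1 := by simp [SkewComm]

theorem SkewComm.mul {s x y : A} {κ μ : ℂ} (hx : SkewComm s x κ) (hy : SkewComm s y μ) :
    SkewComm s (x * y) (κ * μ) := by
  unfold SkewComm at *
  rw [← mul_assoc, hx, smul_mul_assoc, mul_assoc, hy, mul_smul_comm, smul_smul, mul_assoc]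

theorem SkewComm.mul_left {s s' x : A} {κ μ : ℂ} (hs : SkewComm s x κ) (hs' : SkewComm s' x μ) :
    SkewComm (s * s') x (κ * μ) := by
  unfold SkewComm at *
  rw [mul_assoc, hs', mul_smul_comm, ← mul_assoc, hs, smul_mul_assoc, smul_smul, mul_assoc,
    mul_comm μ]

theorem SkewComm.pow {s x : A} {κ : ℂ} (hx : SkewComm s x κ) (n : ℕ) :
    SkewComm s (x ^ n) (κ ^ n) := by
  induction n with
  | zero => simpa using SkewComm.one s
  | succ n ih => rw [pow_succ, pow_succ]; exact ih.mul hx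

theorem SkewComm.flip {s x : A} {κ : ℂ} (hκ : κ ≠ 0) (h : SkewComm s x κ) :
    SkewComm x s κ⁻¹ := by
  unfold SkewComm at *
  rw [h, smul_smul, inv_mul_cancel₀ hκ, one_smul]

/-- Since t^n x = κ^n x t^n, moving a polynomial in t past x only rescales its variable. -/
theorem SkewComm.aeval_mul {t x : A} {κ : ℂ} (h : SkewComm t x κ) (f : ℂ[X]) :
    aeval t f * x = x * aeval t (f.comp (C κ * X)) := by
  induction f using Polynomial.induction_on' with
  | add f g hf hg => simp only [map_add, add_mul, mul_add, add_comp, hf, hg]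
  | monomial n r =>
    have h' : SkewComm (t ^ n) x (κ ^ n) := by
      induction n with
      | zero => simp [SkewComm]
      | succ n ih => rw [pow_succ, pow_succ]; exact ih.mul_left h
    unfold SkewComm at h'
    rw [← C_mul_X_pow_eq_monomial]
    simp only [map_mul, aeval_C, map_pow, aeval_X, mul_comp, C_comp, pow_comp, X_comp, mul_assoc,
      h', mul_pow]
    simp only [Algebra.algebraMap_eq_smul_one, smul_mul_assoc, one_mul, mul_smul_comm,
      _root_.smul_pow, one_pow]

theorem SkewComm.altPow {s x y : A} {κ : ℂ} (hx : SkewComm s x κ) (hy : SkewComm s y κ⁻¹) (n : ℤ) :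
    SkewComm s (altPow x y n) (κ ^ n) := by
  obtain ⟨k, rfl | rfl⟩ := n.eq_nat_or_neg
  · rw [altPow_natCast, zpow_natCast]; exact hx.pow k
  · rw [altPow_neg_natCast, zpow_neg, zpow_natCast, ← inv_pow]; exact hy.pow k

/-- For a nonnegative exponent x simply joins the power. For a negative one it cancels against one
y, which costs the factor x y = F(t). -/
theorem mul_altPow {t x y : A} {F : ℂ[X]} (h : x * y = aeval t F) (n : ℤ) :
    ∃ G : ℂ[X], x * altPow x y n = aeval t G * altPow x y (n + 1) := by
  obtain ⟨k, rfl | rfl⟩ := n.eq_nat_or_neg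
  · refine ⟨1, ?_⟩
    rw [show (k : ℤ) + 1 = ((k + 1 : ℕ) : ℤ) by push_cast; rfl, altPow_natCast, altPow_natCast]
    simp [pow_succ']
  · cases k with
    | zero => exact ⟨1, by simp [altPow]⟩
    | succ k =>
      refine ⟨F, ?_⟩
      rw [show (-((k + 1 : ℕ) : ℤ)) + 1 = -(k : ℤ) by push_cast; ring, altPow_neg_natCast,
        altPow_neg_natCast, pow_succ', ← mul_assoc, h]

theorem mul_altPow' {t x y : A} {F : ℂ[X]} (h : y * x = aeval t F) (n : ℤ) :
    ∃ G : ℂ[X], y * altPow x y n = aeval t G * altPow x y (n - 1) := by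
  obtain ⟨G, hG⟩ := mul_altPow h (-n)
  refine ⟨G, ?_⟩
  rwa [altPow_neg, show -n + 1 = -(n - 1) by ring, altPow_neg] at hG

variable [StarRing A]

/-- `star x * x` is a nonzero polynomial in `t`. -/
def HasPolyModulus (t x : A) : Prop := ∃ P : ℂ[X], P ≠ 0 ∧ star x * x = aeval t P

theorem HasPolyModulus.one (t : A) : HasPolyModulus t 1 := ⟨1, one_ne_zero, by simp⟩

/-- (xy)*(xy) = y* P(t) y = y*y P(κt) = Q(t) P(κt). The product is nonzero because rescaling the
variable by κ ≠ 0 is invertible. -/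
theorem HasPolyModulus.mul {t x y : A} {κ : ℂ} (hx : HasPolyModulus t x) (hy : HasPolyModulus t y)
    (hκ : κ ≠ 0) (h : SkewComm t y κ) : HasPolyModulus t (x * y) := by
  obtain ⟨P, hP, hx⟩ := hx
  obtain ⟨Q, hQ, hy⟩ := hy
  refine ⟨Q * P.comp (C κ * X), mul_ne_zero hQ ?_, ?_⟩
  · intro h0
    have := congrArg (fun f => f.comp (C κ⁻¹ * X)) h0
    simp only [comp_assoc, mul_comp, C_comp, X_comp, zero_comp] at this
    rw [← mul_assoc, ← C_mul, mul_inv_cancel₀ hκ, C_1, one_mul, comp_X] at this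
    exact hP this
  · rw [star_mul, mul_assoc, ← mul_assoc (star x), hx, h.aeval_mul, ← mul_assoc, hy, map_mul]

theorem HasPolyModulus.pow {t x : A} {κ : ℂ} (hx : HasPolyModulus t x)
    (hκ : κ ≠ 0) (h : SkewComm t x κ) (n : ℕ) : HasPolyModulus t (x ^ n) := by
  induction n with
  | zero => simpa using HasPolyModulus.one t
  | succ n ih => rw [pow_succ]; exact ih.mul hx hκ h

theorem HasPolyModulus.altPow {t x y : A} {κ : ℂ} (hx : HasPolyModulus t x)
    (hy : HasPolyModulus t y) (hκ : κ ≠ 0) (h : SkewComm t x κ) (h' : SkewComm t y κ⁻¹) (n : ℤ) :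
    HasPolyModulus t (altPow x y n) := by
  obtain ⟨k, rfl | rfl⟩ := n.eq_nat_or_neg
  · rw [altPow_natCast]; exact hx.pow hκ h k
  · rw [altPow_neg_natCast]; exact hy.pow (inv_ne_zero hκ) h' k

theorem star_aeval [StarModule ℂ A] {t : A} (ht : star t = t) (f : ℂ[X]) :
    star (aeval t f) = aeval t (f.map (starRingEnd ℂ)) := by
  induction f using Polynomial.induction_on' with
  | add f g hf hg => simp only [map_add, star_add, Polynomial.map_add, hf, hg]
  | monomial n r =>
    rw [← C_mul_X_pow_eq_monomial]
    simp [Algebra.algebraMap_eq_smul_one, star_pow, ht]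

end SkewCommutation

/-! ### Homogeneous elements of degree in ℤ³ -/

namespace SUqTheta

section Homogeneous

variable (q θ : ℝ)

/-- The positive element `γ γ*`. -/
noncomputable def modSq : Pol q θ := gen q θ .c * gen q θ .cStar

/-- The monomial of degree `(i, l, m)` in `α, γ, u`. -/
noncomputable def monom (g : ℤ × ℤ × ℤ) : Pol q θ :=
  altPow (gen q θ .u) (gen q θ .uStar) g.2.2 *
    (altPow (gen q θ .a) (gen q θ .aStar) g.1 * altPow (gen q θ .c) (gen q θ .cStar) g.2.1)

/-- The elements of degree `g`. -/
noncomputable def homog (g : ℤ × ℤ × ℤ) : Submodule ℂ (Pol q θ) :=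
  LinearMap.range (LinearMap.mulLeft ℂ (monom q θ g) ∘ₗ (aeval (modSq q θ)).toLinearMap)

/-- The degree of a generator. -/
def deg : Gen → ℤ × ℤ × ℤ
  | .a => (1, 0, 0) | .aStar => (-1, 0, 0)
  | .c => (0, 1, 0) | .cStar => (0, -1, 0)
  | .u => (0, 0, 1) | .uStar => (0, 0, -1)

variable {q θ}

theorem mem_homog {g : ℤ × ℤ × ℤ} {x : Pol q θ} :
    x ∈ homog q θ g ↔ ∃ f : ℂ[X], monom q θ g * aeval (modSq q θ) f = x := by
  simp [homog]

theorem star_modSq : star (modSq q θ) = modSq q θ := by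
  simp [modSq, star_gen, adj]

theorem skew_of_conj {x : Pol q θ} {κ : ℂ} (h : gen q θ .uStar * x * gen q θ .u = κ • x) :
    SkewComm x (gen q θ .u) κ := by
  have := congrArg (gen q θ .u * ·) h
  unfold SkewComm
  simpa only [← mul_assoc, r_uuStar, one_mul, mul_smul_comm] using this

theorem skew_of_conj' {x : Pol q θ} {κ : ℂ} (hκ : κ ≠ 0)
    (h : gen q θ .uStar * x * gen q θ .u = κ • x) : SkewComm x (gen q θ .uStar) κ⁻¹ := by
  have := congrArg (· * gen q θ .uStar) h
  simp only [mul_assoc, r_uuStar, mul_one, smul_mul_assoc] at this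
  rw [SkewComm, this, inv_smul_smul₀ hκ]

theorem conj_phase_ne : conj (phase θ) ≠ 0 := by simpa using phase_ne

theorem skew_c_u : SkewComm (gen q θ .c) (gen q θ .u) (phase θ) := skew_of_conj r_uStarcu
theorem skew_c_uStar : SkewComm (gen q θ .c) (gen q θ .uStar) (phase θ)⁻¹ :=
  skew_of_conj' phase_ne r_uStarcu
theorem skew_cStar_u : SkewComm (gen q θ .cStar) (gen q θ .u) (phase θ)⁻¹ :=
  phase_conj (θ := θ) ▸ skew_of_conj r_uStarcStaru
theorem skew_cStar_uStar : SkewComm (gen q θ .cStar) (gen q θ .uStar) (phase θ)⁻¹⁻¹ :=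
  phase_conj (θ := θ) ▸ skew_of_conj' conj_phase_ne r_uStarcStaru
theorem skew_a_u : SkewComm (gen q θ .a) (gen q θ .u) 1 :=
  skew_of_conj (by rw [one_smul]; exact r_uStarau)
theorem skew_a_uStar : SkewComm (gen q θ .a) (gen q θ .uStar) 1⁻¹ :=
  skew_of_conj' one_ne_zero (by rw [one_smul]; exact r_uStarau)
theorem skew_aStar_u : SkewComm (gen q θ .aStar) (gen q θ .u) 1 :=
  skew_of_conj (by rw [one_smul]; exact r_uStaraStaru)
theorem skew_aStar_uStar : SkewComm (gen q θ .aStar) (gen q θ .uStar) 1⁻¹ :=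
  skew_of_conj' one_ne_zero (by rw [one_smul]; exact r_uStaraStaru)

theorem skew_c_c : SkewComm (gen q θ .c) (gen q θ .c) 1 := by simp [SkewComm]
theorem skew_c_cStar : SkewComm (gen q θ .c) (gen q θ .cStar) 1⁻¹ := by simp [SkewComm, r_cc]
theorem skew_cStar_c : SkewComm (gen q θ .cStar) (gen q θ .c) 1 := by simp [SkewComm, r_cc]
theorem skew_cStar_cStar : SkewComm (gen q θ .cStar) (gen q θ .cStar) 1⁻¹ := by simp [SkewComm]
theorem skew_c_aStar : SkewComm (gen q θ .c) (gen q θ .aStar) q := r_caStar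
theorem skew_cStar_aStar : SkewComm (gen q θ .cStar) (gen q θ .aStar) q := r_cStaraStar

section
variable (hq : q ≠ 0)
include hq
theorem skew_c_a : SkewComm (gen q θ .c) (gen q θ .a) (q : ℂ)⁻¹ :=
  SkewComm.flip (by exact_mod_cast hq) r_ac
theorem skew_cStar_a : SkewComm (gen q θ .cStar) (gen q θ .a) (q : ℂ)⁻¹ :=
  SkewComm.flip (by exact_mod_cast hq) r_acStar

theorem skew_modSq_a : SkewComm (modSq q θ) (gen q θ .a) ((q : ℂ) ^ 2)⁻¹ := by
  have := (skew_c_a (θ := θ) hq).mul_left (skew_cStar_a hq)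
  rwa [← sq, inv_pow] at this

omit hq in
theorem skew_modSq_aStar : SkewComm (modSq q θ) (gen q θ .aStar) ((q : ℂ) ^ 2)⁻¹⁻¹ := by
  have := (skew_c_aStar (q := q) (θ := θ)).mul_left skew_cStar_aStar
  rwa [← sq, ← inv_inv ((q : ℂ) ^ 2)] at this

omit hq in
theorem skew_modSq_c : SkewComm (modSq q θ) (gen q θ .c) 1 := by
  simpa [modSq] using (skew_c_c (q := q) (θ := θ)).mul_left skew_cStar_c

omit hq in
theorem skew_modSq_cStar : SkewComm (modSq q θ) (gen q θ .cStar) 1⁻¹ := by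
  simpa [modSq] using (skew_c_cStar (q := q) (θ := θ)).mul_left skew_cStar_cStar

omit hq in
theorem skew_modSq_u : SkewComm (modSq q θ) (gen q θ .u) 1 := by
  simpa [modSq, phase_ne] using (skew_c_u (q := q) (θ := θ)).mul_left skew_cStar_u

omit hq in
theorem skew_modSq_uStar : SkewComm (modSq q θ) (gen q θ .uStar) 1⁻¹ := by
  simpa [modSq, phase_ne] using (skew_c_uStar (q := q) (θ := θ)).mul_left skew_cStar_uStar

/-- The three commutation lemmas for γ, t and u supply the scalars that tell degrees apart: t
detects i, u detects l, and γ detects m once i is known. -/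
theorem skew_c_monom (g : ℤ × ℤ × ℤ) :
    SkewComm (gen q θ .c) (monom q θ g) (phase θ ^ g.2.2 * (q : ℂ)⁻¹ ^ g.1) := by
  have h := ((skew_c_u (q := q) (θ := θ)).altPow skew_c_uStar g.2.2).mul
    (((skew_c_a hq).altPow (by rw [inv_inv]; exact skew_c_aStar) g.1).mul
      (skew_c_c.altPow skew_c_cStar g.2.1))
  simpa only [one_zpow, mul_one, monom] using h

theorem skew_modSq_monom (g : ℤ × ℤ × ℤ) :
    SkewComm (modSq q θ) (monom q θ g) (((q : ℂ) ^ 2)⁻¹ ^ g.1) := by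
  have h := ((skew_modSq_u (q := q) (θ := θ)).altPow skew_modSq_uStar g.2.2).mul
    (((skew_modSq_a hq).altPow skew_modSq_aStar g.1).mul
      (skew_modSq_c.altPow skew_modSq_cStar g.2.1))
  simpa only [one_zpow, mul_one, one_mul, monom] using h

omit hq in
theorem skew_u_monom (g : ℤ × ℤ × ℤ) :
    SkewComm (gen q θ .u) (monom q θ g) ((phase θ)⁻¹ ^ g.2.1) := by
  have hu : SkewComm (gen q θ .u) (gen q θ .u) 1 := by simp [SkewComm]
  have hu' : SkewComm (gen q θ .u) (gen q θ .uStar) 1⁻¹ := by simp [SkewComm, r_uStaru, r_uuStar]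
  have h := (hu.altPow hu' g.2.2).mul
    (((by simpa using skew_a_u.flip one_ne_zero : SkewComm _ _ 1).altPow (skew_aStar_u.flip one_ne_zero) g.1).mul
      ((skew_c_u.flip phase_ne).altPow (skew_cStar_u.flip (inv_ne_zero phase_ne)) g.2.1))
  simpa only [one_zpow, mul_one, one_mul, inv_one, monom] using h

theorem aeval_mul_monom (f : ℂ[X]) (g : ℤ × ℤ × ℤ) :
    ∃ f' : ℂ[X], aeval (modSq q θ) f * monom q θ g = monom q θ g * aeval (modSq q θ) f' :=
  ⟨_, (skew_modSq_monom hq g).aeval_mul f⟩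

omit hq in
theorem aeval_modSq_X : aeval (modSq q θ) (Polynomial.X : ℂ[X]) = gen q θ .c * gen q θ .cStar := by
  exact aeval_X _

/-- A generator passes, up to a scalar, the powers to its left of its own kind, and is absorbed
there by `mul_altPow` or `mul_altPow'`. The polynomial in t that this produces is moved to the far
right, where it is merely rescaled. -/
theorem gen_mul_monom (s : Gen) (g : ℤ × ℤ × ℤ) :
    ∃ f : ℂ[X], gen q θ s * monom q θ g = monom q θ (g + deg s) * aeval (modSq q θ) f := by
  obtain ⟨i, l, m⟩ := g
  have hAC := fun i l => (((skew_modSq_a (θ := θ) hq).altPow skew_modSq_aStar i).mul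
      (skew_modSq_c.altPow skew_modSq_cStar l)).aeval_mul
  have hC := fun l => ((skew_modSq_c (q := q) (θ := θ)).altPow skew_modSq_cStar l).aeval_mul
  have e1 : gen q θ .a * gen q θ .aStar = aeval (modSq q θ) (1 - C ((q : ℂ) ^ 2) * Polynomial.X) := by
    simp [r_aaStar, modSq, Algebra.smul_def]
  have e2 : gen q θ .aStar * gen q θ .a = aeval (modSq q θ) (1 - Polynomial.X : ℂ[X]) := by
    simp [r_aStara, modSq]
  have e3 : gen q θ .cStar * gen q θ .c = aeval (modSq q θ) (Polynomial.X : ℂ[X]) := by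
    simp [r_cc, modSq]
  have e4 : gen q θ .u * gen q θ .uStar = aeval (modSq q θ) (1 : ℂ[X]) := by simp [r_uuStar]
  have e5 : gen q θ .uStar * gen q θ .u = aeval (modSq q θ) (1 : ℂ[X]) := by simp [r_uStaru]
  cases s with
  | u =>
    obtain ⟨G, hG⟩ := mul_altPow e4 m
    obtain ⟨f, hf⟩ := aeval_mul_monom (θ := θ) hq G (i, l, m + 1)
    refine ⟨f, ?_⟩
    simp only [deg, Prod.mk_add_mk, add_zero]
    rw [← hf, monom, monom, ← mul_assoc, hG, mul_assoc]
  | uStar =>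
    obtain ⟨G, hG⟩ := mul_altPow' e5 m
    obtain ⟨f, hf⟩ := aeval_mul_monom (θ := θ) hq G (i, l, m - 1)
    refine ⟨f, ?_⟩
    simp only [deg, Prod.mk_add_mk, add_zero, ← sub_eq_add_neg]
    rw [← hf, monom, monom, ← mul_assoc, hG, mul_assoc]
  | a =>
    obtain ⟨G, hG⟩ := mul_altPow e1 i
    have hu := (skew_a_u (q := q) (θ := θ)).altPow skew_a_uStar m
    rw [SkewComm, one_zpow, one_smul] at hu
    simp only [deg, Prod.mk_add_mk, add_zero, monom]
    rw [← mul_assoc, hu, mul_assoc, ← mul_assoc (gen q θ .a), hG, mul_assoc (aeval _ G), hAC,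
      ← mul_assoc]
    exact ⟨_, rfl⟩
  | aStar =>
    obtain ⟨G, hG⟩ := mul_altPow' e2 i
    have hu := (skew_aStar_u (q := q) (θ := θ)).altPow skew_aStar_uStar m
    rw [SkewComm, one_zpow, one_smul] at hu
    simp only [deg, Prod.mk_add_mk, add_zero, ← sub_eq_add_neg, monom]
    rw [← mul_assoc, hu, mul_assoc, ← mul_assoc (gen q θ .aStar), hG, mul_assoc (aeval _ G), hAC,
      ← mul_assoc]
    exact ⟨_, rfl⟩
  | c =>
    obtain ⟨G, hG⟩ := mul_altPow (aeval_modSq_X (q := q) (θ := θ)).symm l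
    have hu := ((skew_c_u (q := q) (θ := θ)).altPow skew_c_uStar m).mul
      ((skew_c_a hq).altPow (by rw [inv_inv]; exact skew_c_aStar) i)
    rw [SkewComm] at hu
    simp only [deg, Prod.mk_add_mk, add_zero, monom]
    rw [← mul_assoc (altPow _ _ m), ← mul_assoc, hu, smul_mul_assoc, mul_assoc, hG, hC,
      ← mul_assoc, mul_assoc (altPow _ _ m), mul_assoc, ← mul_smul_comm, ← mul_smul_comm,
      ← map_smul]
    exact ⟨_, by simp only [mul_assoc]; rfl⟩
  | cStar =>
    obtain ⟨G, hG⟩ := mul_altPow' e3 l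
    have hu := ((skew_cStar_u (q := q) (θ := θ)).altPow skew_cStar_uStar m).mul
      ((skew_cStar_a hq).altPow (by rw [inv_inv]; exact skew_cStar_aStar) i)
    rw [SkewComm] at hu
    simp only [deg, Prod.mk_add_mk, add_zero, ← sub_eq_add_neg, monom]
    rw [← mul_assoc (altPow _ _ m), ← mul_assoc, hu, smul_mul_assoc, mul_assoc, hG, hC,
      ← mul_assoc, mul_assoc (altPow _ _ m), mul_assoc, ← mul_smul_comm, ← mul_smul_comm,
      ← map_smul]
    exact ⟨_, by simp only [mul_assoc]; rfl⟩

theorem gen_mul_mem_homog (s : Gen) {g : ℤ × ℤ × ℤ} {x : Pol q θ} (hx : x ∈ homog q θ g) :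
    gen q θ s * x ∈ homog q θ (g + deg s) := by
  rw [mem_homog] at hx ⊢
  obtain ⟨f, rfl⟩ := hx
  obtain ⟨f', h⟩ := gen_mul_monom (θ := θ) hq s g
  exact ⟨f' * f, by rw [map_mul, ← mul_assoc, ← h, mul_assoc]⟩

/-- The moduli of the generators are 1 - t for α, 1 - q²t for α*, t for γ and γ*, and 1 for u and
u*. All commute with t up to nonzero scalars, so moduli multiply. -/
theorem hasPolyModulus_monom (g : ℤ × ℤ × ℤ) :
    HasPolyModulus (modSq q θ) (monom q θ g) := by
  have hq' : ((q : ℂ) ^ 2) ≠ 0 := by exact_mod_cast pow_ne_zero 2 hq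
  have ha : HasPolyModulus (modSq q θ) (gen q θ .a) :=
    ⟨1 - Polynomial.X, fun h => by simpa using congrArg (eval 0) h, by
      simp [star_gen, adj, r_aStara, modSq]⟩
  have ha' : HasPolyModulus (modSq q θ) (gen q θ .aStar) :=
    ⟨1 - C ((q : ℂ) ^ 2) * Polynomial.X, fun h => by simpa using congrArg (eval 0) h, by
      simp [star_gen, adj, r_aaStar, modSq, Algebra.smul_def]⟩
  have hc : HasPolyModulus (modSq q θ) (gen q θ .c) :=
    ⟨Polynomial.X, X_ne_zero, by simp [star_gen, adj, r_cc, modSq]⟩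
  have hc' : HasPolyModulus (modSq q θ) (gen q θ .cStar) :=
    ⟨Polynomial.X, X_ne_zero, by simp [star_gen, adj, modSq]⟩
  have hu : HasPolyModulus (modSq q θ) (gen q θ .u) :=
    ⟨1, one_ne_zero, by simp [star_gen, adj, r_uStaru]⟩
  have hu' : HasPolyModulus (modSq q θ) (gen q θ .uStar) :=
    ⟨1, one_ne_zero, by simp [star_gen, adj, r_uuStar]⟩
  have sC := (skew_modSq_c (q := q) (θ := θ)).altPow skew_modSq_cStar g.2.1
  have sA := (skew_modSq_a (θ := θ) hq).altPow skew_modSq_aStar g.1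
  have hC := hc.altPow hc' one_ne_zero skew_modSq_c skew_modSq_cStar g.2.1
  have hA := ha.altPow ha' (inv_ne_zero hq') (skew_modSq_a hq) skew_modSq_aStar g.1
  have hU := hu.altPow hu' one_ne_zero skew_modSq_u skew_modSq_uStar g.2.2
  have k := mul_ne_zero (zpow_ne_zero g.1 (inv_ne_zero hq'))
    (zpow_ne_zero g.2.1 (one_ne_zero (α := ℂ)))
  exact hU.mul (hA.mul hC (zpow_ne_zero _ one_ne_zero) sC) k (sA.mul sC)

/-- A nonzero element of degree `g` has a nonzero polynomial in `γ γ*` as its modulus. -/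
theorem exists_modulus_of_mem_homog {g : ℤ × ℤ × ℤ} {x : Pol q θ} (hx : x ∈ homog q θ g) :
    ∃ P : ℂ[X], star x * x = aeval (modSq q θ) P ∧ (P = 0 → x = 0) := by
  rw [mem_homog] at hx
  obtain ⟨f, rfl⟩ := hx
  obtain ⟨P, hP, h⟩ := hasPolyModulus_monom (θ := θ) hq g
  refine ⟨f.map (starRingEnd ℂ) * (P * f), ?_, fun h0 => ?_⟩
  · rw [star_mul, star_aeval star_modSq, mul_assoc, ← mul_assoc (star (monom q θ g)), h, map_mul,
      map_mul]
  · have : f = 0 := by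
      rcases mul_eq_zero.1 h0 with h0 | h0
      · exact (Polynomial.map_eq_zero _).1 h0
      · exact (mul_eq_zero.1 h0).resolve_left hP
    simp [this]

omit hq in
theorem skew_mul_aeval {s x : Pol q θ} {κ : ℂ} (h : SkewComm s x κ)
    (hs : SkewComm (modSq q θ) s 1) (f : ℂ[X]) : SkewComm s (x * aeval (modSq q θ) f) κ := by
  have : SkewComm s (aeval (modSq q θ) f) 1 := by
    simpa [SkewComm] using (hs.aeval_mul f).symm
  simpa using h.mul this

theorem skew_c_of_mem_homog {g : ℤ × ℤ × ℤ} {x : Pol q θ} (hx : x ∈ homog q θ g) :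
    SkewComm (gen q θ .c) x (phase θ ^ g.2.2 * (q : ℂ)⁻¹ ^ g.1) := by
  obtain ⟨f, rfl⟩ := mem_homog.1 hx
  exact skew_mul_aeval (skew_c_monom hq g) skew_modSq_c f

theorem skew_modSq_of_mem_homog {g : ℤ × ℤ × ℤ} {x : Pol q θ} (hx : x ∈ homog q θ g) :
    SkewComm (modSq q θ) x (((q : ℂ) ^ 2)⁻¹ ^ g.1) := by
  obtain ⟨f, rfl⟩ := mem_homog.1 hx
  exact skew_mul_aeval (skew_modSq_monom hq g) (by simp [SkewComm]) f

omit hq in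
theorem skew_u_of_mem_homog {g : ℤ × ℤ × ℤ} {x : Pol q θ} (hx : x ∈ homog q θ g) :
    SkewComm (gen q θ .u) x ((phase θ)⁻¹ ^ g.2.1) := by
  obtain ⟨f, rfl⟩ := mem_homog.1 hx
  exact skew_mul_aeval (skew_u_monom g) skew_modSq_u f

/-- The degrees with all entries between `-d` and `d`. -/
noncomputable def box (d : ℕ) : Finset (ℤ × ℤ × ℤ) := Finset.Icc (-(d : ℤ), -(d : ℤ), -(d : ℤ)) (d, d, d)

omit hq in
theorem card_box (d : ℕ) : (box d).card = (2 * d + 1) ^ 3 := by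
  have : ((d : ℤ) + 1 + d).toNat = 2 * d + 1 := by omega
  simp only [box, Finset.Icc_prod_def, Finset.card_product, Int.card_Icc, sub_neg_eq_add, this]
  ring

variable (q θ) in
/-- The span of the generators and the unit. -/
noncomputable def genSpan : Submodule ℂ (Pol q θ) :=
  Submodule.span ℂ (insert 1 (Set.range (gen q θ)))

omit hq in
theorem one_le_genSpan : 1 ≤ genSpan q θ := by
  rw [Submodule.one_le]
  exact Submodule.subset_span (Set.mem_insert _ _)

omit hq in
theorem exists_mem_genSpan_pow (x : Pol q θ) : ∃ d : ℕ, x ∈ genSpan q θ ^ d := by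
  induction x using induct with
  | hs r =>
    refine ⟨0, ?_⟩
    rw [pow_zero]
    exact Submodule.algebraMap_mem r
  | hg g =>
    refine ⟨1, ?_⟩
    rw [pow_one]
    exact Submodule.subset_span (Set.mem_insert_of_mem _ ⟨g, rfl⟩)
  | hm x y hx hy =>
    obtain ⟨d, hx⟩ := hx
    obtain ⟨e, hy⟩ := hy
    exact ⟨d + e, by rw [pow_add]; exact Submodule.mul_mem_mul hx hy⟩
  | ha x y hx hy =>
    obtain ⟨d, hx⟩ := hx
    obtain ⟨e, hy⟩ := hy
    exact ⟨max d e, add_mem (pow_le_pow_right' one_le_genSpan (le_max_left _ _) hx)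
      (pow_le_pow_right' one_le_genSpan (le_max_right _ _) hy)⟩

/-- Each generator changes one coordinate of the degree by one, so words of length d meet only the
box of side 2d + 1. It matters that the number of degrees grows polynomially in d; directness of the
sum is not needed. -/
theorem genSpan_pow_le (d : ℕ) : genSpan q θ ^ d ≤ ⨆ g ∈ box d, homog q θ g := by
  induction d with
  | zero =>
    rw [pow_zero, Submodule.one_le]
    refine (le_iSup₂_of_le (0, 0, 0) (by simp [box]) le_rfl : homog q θ (0, 0, 0) ≤ _) ?_
    exact mem_homog.2 ⟨1, by simp [monom, altPow_zero]⟩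
  | succ d ih =>
    rw [pow_succ']
    refine (mul_le_mul_right ih _).trans ?_
    simp only [Submodule.mul_iSup]
    refine iSup₂_le fun g hg => Submodule.mul_le.2 fun s hs x hx => ?_
    have hg' := Finset.mem_Icc.1 hg
    simp only [Prod.le_def] at hg'
    have hle : ∀ h ∈ box (d + 1), homog q θ h ≤ ⨆ g ∈ box (d + 1), homog q θ g :=
      fun h hh => le_iSup₂_of_le h hh le_rfl
    rw [genSpan] at hs
    induction hs using Submodule.span_induction with
    | mem s hs =>
      rcases hs with rfl | ⟨s, rfl⟩
      · rw [one_mul]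
        refine hle g ?_ hx
        simp only [box, Finset.mem_Icc, Prod.le_def]
        push_cast
        omega
      · refine hle _ ?_ (gen_mul_mem_homog hq s hx)
        simp only [box, Finset.mem_Icc, Prod.le_def]
        push_cast
        cases s <;> simp [deg] <;> omega
    | zero => rw [zero_mul]; exact zero_mem _
    | add s s' _ _ h h' => rw [add_mul]; exact add_mem h h'
    | smul r s _ h => rw [smul_mul_assoc]; exact Submodule.smul_mem _ r h

theorem exists_homog_decomposition {d : ℕ} {x : Pol q θ} (hx : x ∈ genSpan q θ ^ d) :
    ∃ y : ℤ × ℤ × ℤ → Pol q θ, (∀ g, y g ∈ homog q θ g) ∧ x = ∑ g ∈ box d, y g := by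
  have := genSpan_pow_le hq d hx
  rw [Submodule.mem_iSup_finset_iff_exists_sum] at this
  obtain ⟨μ, h⟩ := this
  exact ⟨fun g => μ g, fun g => (μ g).2, h.symm⟩
end

end Homogeneous
end SUqTheta


/-! ### Spectrum and eigenelements from the quantum disc relations -/

section QuantumDisc

variable {B : Type*} [CStarAlgebra B] {q : ℝ} {a t : B}

/-- The set `{0} ∪ {q ^ (2 n)}`. -/
def geomSpectrum (q : ℝ) : Set ℂ := insert 0 (Set.range fun n : ℕ => ((q : ℂ) ^ 2) ^ n)

/-- a*a = 1 - t and aa* = 1 - q²t have the same nonzero spectrum; compare them at the point 1 - q²z,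
which is nonzero by hypothesis. -/
theorem mem_spectrum_iff_of_quantumDisc (hq : q ≠ 0) (h₁ : star a * a = 1 - t)
    (h₂ : a * star a = 1 - (q : ℂ) ^ 2 • t) {z : ℂ} (hz : (q : ℂ) ^ 2 * z ≠ 1) :
    z ∈ spectrum ℂ t ↔ (q : ℂ) ^ 2 * z ∈ spectrum ℂ t := by
  have hq' : (q : ℂ) ^ 2 ≠ 0 := by exact_mod_cast pow_ne_zero 2 hq
  have key : ∀ (w : ℂ) (x : B), 1 - w ∈ spectrum ℂ (1 - x) ↔ w ∈ spectrum ℂ x := by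
    intro w x
    rw [← map_one (algebraMap ℂ B), ← spectrum.singleton_sub_eq]
    simp
  have h := Set.ext_iff.1 (spectrum.nonzero_mul_comm (𝕜 := ℂ) (star a) a) (1 - (q : ℂ) ^ 2 * z)
  rw [h₁, h₂] at h
  simp only [Set.mem_sdiff, key, Set.mem_singleton_iff, sub_eq_zero, hz.symm, not_false_eq_true,
    and_true] at h
  rw [h]
  exact (spectrum.smul_mem_smul_iff (r := Units.mk0 _ hq')).symm

/-- Both t = c*c and 1 - t = a*a are positive. -/
theorem exists_ofReal_of_mem_spectrum (h₁ : star a * a = 1 - t) (h₃ : ∃ c, t = star c * c)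
    {z : ℂ} (hz : z ∈ spectrum ℂ t) : ∃ r : ℝ, z = r ∧ 0 ≤ r ∧ r ≤ 1 := by
  obtain ⟨c, rfl⟩ := h₃
  have ht : IsSelfAdjoint (star c * c) := .star_mul_self c
  refine ⟨z.re, ht.mem_spectrum_eq_re hz, ?_, ?_⟩
  · rw [ht.mem_spectrum_eq_re hz] at hz
    exact spectrum_star_mul_self_nonneg _ ((spectrum.algebraMap_mem_iff ℂ).1 hz)
  · have h : 1 - z ∈ spectrum ℂ (star a * a) := by
      rw [h₁, ← map_one (algebraMap ℂ B), ← spectrum.singleton_sub_eq]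
      exact Set.sub_mem_sub rfl hz
    rw [(IsSelfAdjoint.star_mul_self a).mem_spectrum_eq_re h] at h
    have := spectrum_star_mul_self_nonneg _ ((spectrum.algebraMap_mem_iff ℂ).1 h)
    have h' : (0 : ℝ) ≤ (1 - z).re := this
    simpa using h'

/-- The spectrum of `t` in a representation of the quantum disc relations. -/
theorem spectrum_eq_of_quantumDisc (hq : q ≠ 0) (hq1 : -1 < q) (hq2 : q < 1)
    (h₁ : star a * a = 1 - t) (h₂ : a * star a = 1 - (q : ℂ) ^ 2 • t)
    (h₃ : ∃ c, t = star c * c) (ht : t ≠ 0) : spectrum ℂ t = geomSpectrum q := by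
  have hr0 : 0 < q ^ 2 := by positivity
  have hr1 : q ^ 2 < 1 := by nlinarith
  have step := fun z => mem_spectrum_iff_of_quantumDisc (z := z) hq h₁ h₂
  have sub : ∀ z ∈ spectrum ℂ t, z ∈ geomSpectrum q := by
    intro z hz
    by_contra hcon
    simp only [geomSpectrum, Set.mem_insert_iff, Set.mem_range, not_or, not_exists] at hcon
    obtain ⟨r, rfl, hr, -⟩ := exists_ofReal_of_mem_spectrum h₁ h₃ hz
    have hrpos : 0 < r := lt_of_le_of_ne hr fun h => hcon.1 (by simp [← h])
    -- A spectral point r > 0 that is no power of q² can be divided by q² indefinitely, since the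
    -- excluded value 1 is never met. The quotients eventually exceed 1, a contradiction.
    have all : ∀ n : ℕ, ((r / (q ^ 2) ^ n : ℝ) : ℂ) ∈ spectrum ℂ t := by
      intro n
      induction n with
      | zero => simpa using hz
      | succ n ih =>
        have e : (q : ℂ) ^ 2 * ((r / (q ^ 2) ^ (n + 1) : ℝ) : ℂ) = ((r / (q ^ 2) ^ n : ℝ) : ℂ) := by
          have : q ^ 2 * (r / (q ^ 2) ^ (n + 1)) = r / (q ^ 2) ^ n := by field_simp; ring
          exact_mod_cast this
        rw [step, e]
        · exact ih
        · rw [e]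
          intro h1
          have h1' : r / (q ^ 2) ^ n = 1 := by exact_mod_cast h1
          rw [div_eq_one_iff_eq (by positivity)] at h1'
          exact hcon.2 n (by rw [h1']; push_cast; rfl)
    obtain ⟨n, hn⟩ := exists_pow_lt_of_lt_one hrpos hr1
    obtain ⟨s, hs, -, hs1⟩ := exists_ofReal_of_mem_spectrum h₁ h₃ (all n)
    have hs' : r / (q ^ 2) ^ n = s := by exact_mod_cast hs
    rw [← hs', div_le_one (by positivity)] at hs1
    linarith
  -- Multiplying by q² never reaches the excluded value 1, so all powers of q² lie in the spectrum
  -- or none does.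
  have shift : ∀ n : ℕ, ((q : ℂ) ^ 2) ^ n ∈ spectrum ℂ t ↔ 1 ∈ spectrum ℂ t := by
    intro n
    induction n with
    | zero => simp
    | succ n ih =>
      rw [← ih, step (((q : ℂ) ^ 2) ^ n), ← pow_succ']
      rw [← pow_succ']
      exact_mod_cast (pow_lt_one₀ hr0.le hr1 n.succ_ne_zero).ne
  have hsa : IsSelfAdjoint t := by
    obtain ⟨c, rfl⟩ := h₃
    exact .star_mul_self c
  -- If none did, the spectrum would be contained in {0}, and the selfadjoint t would vanish.
  have one : 1 ∈ spectrum ℂ t := by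
    by_contra h1
    have : spectrum ℂ t ⊆ {0} := by
      intro z hz
      rcases sub z hz with rfl | ⟨n, rfl⟩
      · rfl
      · exact absurd ((shift n).1 hz) h1
    have hrad : spectralRadius ℂ t = 0 := by
      refine le_antisymm (iSup₂_le fun z hz => ?_) bot_le
      rw [this hz]
      simp
    rw [hsa.spectralRadius_eq_nnnorm] at hrad
    exact ht (by simpa using hrad)
  refine Set.Subset.antisymm sub ?_
  rintro z (rfl | ⟨n, rfl⟩)
  · have : Filter.Tendsto (fun n : ℕ => ((q : ℂ) ^ 2) ^ n) Filter.atTop (nhds 0) := by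
      refine tendsto_pow_atTop_nhds_zero_of_norm_lt_one ?_
      rw [norm_pow, Complex.norm_real, Real.norm_eq_abs, sq_abs]
      exact hr1
    exact (spectrum.isClosed t).mem_of_tendsto this (.of_forall fun n => (shift n).2 one)
  · exact (shift n).2 one

/-- The norm of a polynomial in a normal element only depends on the spectrum. -/
theorem norm_aeval_le_of_forall_mem_spectrum [Nontrivial B] {t : B} (ht : IsSelfAdjoint t)
    {P : ℂ[X]} {C : ℝ} (h : ∀ z ∈ spectrum ℂ t, ‖P.eval z‖ ≤ C) : ‖aeval t P‖ ≤ C := by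
  have hn : IsStarNormal (aeval t P) := by
    rw [isStarNormal_iff, star_aeval ht]
    exact (Commute.all _ _).map (aeval t)
  have hC : 0 ≤ C := by
    obtain ⟨z, hz⟩ := spectrum.nonempty t
    exact (norm_nonneg _).trans (h z hz)
  lift C to NNReal using hC
  rw [← coe_nnnorm, NNReal.coe_le_coe, ← ENNReal.coe_le_coe,
    ← IsStarNormal.spectralRadius_eq_nnnorm]
  refine iSup₂_le fun w hw => ?_
  rw [spectrum.map_polynomial_aeval] at hw
  obtain ⟨z, hz, rfl⟩ := hw
  exact ENNReal.coe_le_coe.2 (h z hz)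

theorem norm_eval_le_norm_aeval [Nontrivial B] (t : B) (P : ℂ[X]) {z : ℂ}
    (hz : z ∈ spectrum ℂ t) : ‖P.eval z‖ ≤ ‖aeval t P‖ := by
  refine spectrum.norm_le_norm_of_mem ?_
  rw [spectrum.map_polynomial_aeval]
  exact ⟨z, hz, rfl⟩

/-- For a nonzero point of the spectrum there is a selfadjoint contraction of norm one all of
whose range consists of eigenvectors. -/
theorem exists_eigenelement [Nontrivial B] (hq : q ≠ 0) (hq1 : -1 < q) (hq2 : q < 1)
    (ht : IsSelfAdjoint t) (hsp : spectrum ℂ t = geomSpectrum q) (n : ℕ) :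
    ∃ p : B, IsSelfAdjoint p ∧ ‖p‖ = 1 ∧ t * p = ((q : ℂ) ^ 2) ^ n • p ∧
      ∀ b, Commute t b → Commute p b := by
  have hr0 : 0 < q ^ 2 := by positivity
  have hr1 : q ^ 2 < 1 := by nlinarith
  set s : ℝ := (q ^ 2) ^ n with hs
  have hsC : ((q : ℂ) ^ 2) ^ n = s := by rw [hs]; push_cast; rfl
  have hs0 : 0 < s := by positivity
  -- δ bounds from below the distance from s = q^(2n) to the rest of the spectrum: the nearest
  -- smaller point is q²s, and larger points are further away. The tent function of radius δ at s is
  -- therefore the indicator of s on the spectrum.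
  set δ : ℝ := s * (1 - q ^ 2) with hδ
  have hδ0 : 0 < δ := mul_pos hs0 (by linarith)
  set f : ℂ → ℂ := fun z => ((max 0 (1 - ‖z - s‖ / δ) : ℝ) : ℂ) with hf
  have hfc : Continuous f := by fun_prop
  have hfs : f s = 1 := by simp [hf]
  have hf0 : ∀ z ∈ spectrum ℂ t, z ≠ s → f z = 0 := by
    intro z hz hzs
    rw [hsp] at hz
    have : δ ≤ ‖z - s‖ := by
      rcases hz with rfl | ⟨m, rfl⟩
      · rw [zero_sub, norm_neg, Complex.norm_real, Real.norm_of_nonneg hs0.le]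
        nlinarith
      · have e : ((q : ℂ) ^ 2) ^ m - s = (((q ^ 2) ^ m - s : ℝ) : ℂ) := by push_cast; rfl
        have hmn : m ≠ n := by
          rintro rfl
          exact hzs hsC
        simp only
        rw [e, Complex.norm_real, Real.norm_eq_abs]
        rcases hmn.lt_or_gt with h | h
        · obtain ⟨k, rfl⟩ := Nat.exists_eq_add_of_lt h
          have h1 : s = (q ^ 2) ^ m * (q ^ 2) ^ (k + 1) := by rw [hs, ← pow_add]; rfl
          have h2 : (q ^ 2) ^ (k + 1) ≤ q ^ 2 := by
            rw [pow_succ]; exact mul_le_of_le_one_left hr0.le (pow_le_one₀ hr0.le hr1.le)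
          have h3 : 0 < (q ^ 2) ^ m := by positivity
          have h4 : s ≤ (q ^ 2) ^ m := by rw [h1]; nlinarith
          refine le_trans ?_ (le_abs_self _)
          nlinarith [mul_le_mul_of_nonneg_left h2 h3.le]
        · obtain ⟨k, rfl⟩ := Nat.exists_eq_add_of_lt h
          have h1 : (q ^ 2) ^ (n + k + 1) = s * (q ^ 2) ^ (k + 1) := by rw [hs, ← pow_add]; rfl
          have h2 : (q ^ 2) ^ (k + 1) ≤ q ^ 2 := by
            rw [pow_succ]; exact mul_le_of_le_one_left hr0.le (pow_le_one₀ hr0.le hr1.le)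
          rw [abs_sub_comm, h1]
          refine le_trans ?_ (le_abs_self _)
          nlinarith
    have h1 : 1 - ‖z - s‖ / δ ≤ 0 := by
      rw [sub_nonpos, one_le_div hδ0]
      exact this
    simp only [hf]
    rw [max_eq_left h1, Complex.ofReal_zero]
  have hsmem : (s : ℂ) ∈ spectrum ℂ t := by
    rw [hsp]
    exact Or.inr ⟨n, hsC⟩
  have htn : IsStarNormal t := ht.isStarNormal
  refine ⟨cfc f t, ?_, ?_, ?_, fun b hb => ht.commute_cfc hb f⟩
  · rw [IsSelfAdjoint, ← cfc_star]
    simp [hf]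
  · obtain ⟨⟨z, hz, h1⟩, h2⟩ := IsGreatest.norm_cfc f t hfc.continuousOn htn
    refine le_antisymm ?_ ?_
    · rw [← h1]
      by_cases hzs : z = s
      · simp [hzs, hfs]
      · simp [hf0 z hz hzs]
    · simpa [hfs] using h2 ⟨_, hsmem, rfl⟩
  · rw [hsC]
    nth_rw 1 [← cfc_id ℂ t]
    rw [← cfc_mul id f t continuousOn_id hfc.continuousOn,
      ← cfc_smul (s : ℂ) f t hfc.continuousOn]
    refine cfc_congr fun z hz => ?_
    by_cases hzs : z = s
    · simp [hzs]
    · simp [hf0 z hz hzs]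

end QuantumDisc


/-! ### Averages of unimodular powers -/

section Averaging

/-- For w ≠ 1 the geometric sums stay bounded by 2 / ‖w - 1‖. -/
theorem tendsto_average_unimodular_pow {w : ℂ} (hw : ‖w‖ = 1) :
    Filter.Tendsto (fun M : ℕ => (M : ℂ)⁻¹ * ∑ k ∈ Finset.range M, w ^ k) Filter.atTop
      (nhds (if w = 1 then 1 else 0)) := by
  split_ifs with h
  · subst h
    refine tendsto_const_nhds.congr' ?_
    filter_upwards [Filter.eventually_ne_atTop 0] with M hM
    have : (M : ℂ) ≠ 0 := by exact_mod_cast hM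
    simp [this]
  · have hw1 : 0 < ‖w - 1‖ := norm_pos_iff.2 (sub_ne_zero.2 h)
    have h0 : Filter.Tendsto (fun M : ℕ => ((M : ℝ)⁻¹ * (2 / ‖w - 1‖))) Filter.atTop (nhds 0) := by
      simpa using (tendsto_inv_atTop_nhds_zero_nat (𝕜 := ℝ)).mul_const (2 / ‖w - 1‖)
    refine squeeze_zero_norm (fun M => ?_) h0
    rw [geom_sum_eq h, norm_mul, norm_inv, Complex.norm_natCast, norm_div]
    gcongr
    refine (norm_sub_le _ _).trans ?_
    rw [norm_pow, hw]
    norm_num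

/-- If all the sums `∑ c j ^ k • y j` are bounded by `C`, then so is the sum of the `y j` with
`c j = z`. -/
theorem norm_sum_filter_le_of_forall_pow {E ι : Type*} [NormedAddCommGroup E] [NormedSpace ℂ E]
    (S : Finset ι) (c : ι → ℂ) (y : ι → E) {C : ℝ} (hc : ∀ j ∈ S, ‖c j‖ = 1)
    (h : ∀ k : ℕ, ‖∑ j ∈ S, c j ^ k • y j‖ ≤ C) {z : ℂ} (hz : ‖z‖ = 1) :
    ‖∑ j ∈ S with c j = z, y j‖ ≤ C := by
  have hz0 : z ≠ 0 := by rintro rfl; simp at hz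
  have hlim : Filter.Tendsto (fun M : ℕ => ∑ j ∈ S,
      ((M : ℂ)⁻¹ * ∑ k ∈ Finset.range M, (c j / z) ^ k) • y j) Filter.atTop
      (nhds (∑ j ∈ S with c j = z, y j)) := by
    rw [Finset.sum_filter]
    refine tendsto_finsetSum _ fun j hj => ?_
    have := (tendsto_average_unimodular_pow (w := c j / z)
      (by rw [norm_div, hc j hj, hz, div_one])).smul_const (y j)
    simpa only [div_eq_one_iff_eq hz0, ite_smul, one_smul, zero_smul] using this
  have hC : 0 ≤ C := (norm_nonneg _).trans (h 0)
  refine le_of_tendsto hlim.norm (.of_forall fun M => ?_)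
  -- The averaged sum is a mean of the given sums multiplied by the unimodular scalars z^(-k), so
  -- the bound C survives averaging.
  have e : ∑ j ∈ S, ((M : ℂ)⁻¹ * ∑ k ∈ Finset.range M, (c j / z) ^ k) • y j =
      (M : ℂ)⁻¹ • ∑ k ∈ Finset.range M, (z ^ k)⁻¹ • ∑ j ∈ S, c j ^ k • y j := by
    simp only [Finset.mul_sum, Finset.sum_smul, Finset.smul_sum, smul_smul]
    rw [Finset.sum_comm]
    refine Finset.sum_congr rfl fun k _ => Finset.sum_congr rfl fun j _ => ?_
    rw [div_pow]
    congr 1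
    ring
  rw [e, norm_smul, norm_inv, Complex.norm_natCast]
  have h2 : ‖∑ k ∈ Finset.range M, (z ^ k)⁻¹ • ∑ j ∈ S, c j ^ k • y j‖ ≤ M * C := by
    refine (norm_sum_le_of_le _ (f := fun k => (z ^ k)⁻¹ • ∑ j ∈ S, c j ^ k • y j)
      (n := fun _ => C) fun k _ => ?_).trans (by simp)
    rw [norm_smul, norm_inv, norm_pow, hz]
    simpa using h k
  rcases Nat.eq_zero_or_pos M with rfl | hM
  · simpa using hC
  · rw [inv_mul_le_iff₀ (by exact_mod_cast hM)]
    exact h2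

end Averaging

/-! ### Norm identities from orthogonality and eigenvalues -/

section CStarNorm

variable {B : Type*} [CStarAlgebra B]

/-- By orthogonality z*(z + w) = z*z, whence ‖z‖² ≤ ‖z‖ ‖z + w‖. -/
theorem norm_le_norm_add_of_star_mul_eq_zero {z w : B} (h : star z * w = 0) :
    ‖z‖ ≤ ‖z + w‖ := by
  have h1 : star z * (z + w) = star z * z := by rw [mul_add, h, add_zero]
  have h2 : ‖z‖ * ‖z‖ ≤ ‖z‖ * ‖z + w‖ := by
    rw [← CStarRing.norm_star_mul_self, ← h1, ← norm_star z]
    exact norm_mul_le _ _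
  by_cases h0 : ‖z‖ = 0
  · rw [h0]; exact norm_nonneg _
  · exact le_of_mul_le_mul_left h2 (lt_of_le_of_ne (norm_nonneg _) (Ne.symm h0))

/-- On an eigenspace of c*c, c is a multiple of an isometry: the left factor scales the norm by r√s
and the right one by √s. This lets conjugation by γ replace conjugation by a unitary. -/
theorem norm_mul_mul_star_of_eigen {c R t : B} {r s : ℝ} (hr : 0 ≤ r) (hs : 0 ≤ s)
    (hc : star c * c = t) (hl : t * R = ((r ^ 2 * s : ℝ) : ℂ) • R) (hR : R * t = (s : ℂ) • R) :
    ‖c * R * star c‖ = r * s * ‖R‖ := by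
  have h1 : ‖c * R‖ * ‖c * R‖ = r ^ 2 * s * (‖R‖ * ‖R‖) := by
    rw [← CStarRing.norm_star_mul_self, star_mul, mul_assoc, ← mul_assoc (star c), hc, hl,
      mul_smul_comm, norm_smul, CStarRing.norm_star_mul_self, Complex.norm_real,
      Real.norm_of_nonneg (by positivity)]
  have h2 : ‖c * R * star c‖ * ‖c * R * star c‖ = s * (‖c * R‖ * ‖c * R‖) := by
    rw [← CStarRing.norm_self_mul_star, star_mul, star_star, mul_assoc (c * R),
      ← mul_assoc (star c), hc, mul_assoc c R, ← mul_assoc R t, hR, smul_mul_assoc, mul_smul_comm,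
      norm_smul, Complex.norm_real, Real.norm_of_nonneg hs, ← mul_assoc c R, star_mul,
      ← star_mul, CStarRing.norm_self_mul_star]
  rw [h1] at h2
  refine (mul_self_inj (norm_nonneg _) (by positivity)).1 ?_
  rw [h2]; ring

theorem aeval_mul_of_eigen {A : Type*} [Ring A] [Algebra ℂ A] {t p : A} {s : ℂ}
    (h : t * p = s • p) (f : ℂ[X]) : aeval t f * p = f.eval s • p := by
  induction f using Polynomial.induction_on' with
  | add f g hf hg => rw [map_add, add_mul, hf, hg, eval_add, add_smul]
  | monomial n r =>
    have h' : t ^ n * p = s ^ n • p := by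
      induction n with
      | zero => simp
      | succ n ih => rw [pow_succ, mul_assoc, h, mul_smul_comm, ih, smul_smul, pow_succ']
    simp [← C_mul_X_pow_eq_monomial, h', Algebra.algebraMap_eq_smul_one, smul_smul]

end CStarNorm

namespace SUqTheta

theorem norm_phase (θ : ℝ) : ‖phase θ‖ = 1 := by
  rw [phase, show 2 * (Real.pi : ℂ) * Complex.I * θ = ((2 * Real.pi * θ : ℝ) : ℂ) * Complex.I by
    push_cast; ring]
  exact Complex.norm_exp_ofReal_mul_I _

/-- A coincidence of two powers would make a nonzero integer multiple of θ an integer. -/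
theorem phase_zpow_injective {θ : ℝ} (hθ : Irrational θ) :
    Function.Injective fun m : ℤ => phase θ ^ m := by
  intro m n h
  by_contra hmn
  have h1 : phase θ ^ (m - n) = 1 := by
    rw [zpow_sub₀ phase_ne, div_eq_one_iff_eq (zpow_ne_zero _ phase_ne)]
    exact h
  rw [phase, ← Complex.exp_int_mul, Complex.exp_eq_one_iff] at h1
  obtain ⟨k, hk⟩ := h1
  have h2 : ((m - n : ℤ) : ℂ) * θ = k := by
    have : (2 * Real.pi * Complex.I : ℂ) ≠ 0 := Complex.two_pi_I_ne_zero
    apply mul_right_cancel₀ this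
    rw [← hk]; ring
  have h3 : ((m - n : ℤ) : ℝ) * θ = k := by exact_mod_cast h2
  exact (hθ.intCast_mul (sub_ne_zero.2 hmn)).ne_int k h3

end SUqTheta


theorem SkewComm.map {A B F : Type*} [Ring A] [Algebra ℂ A] [Ring B] [Algebra ℂ B] [FunLike F A B]
    [AlgHomClass F ℂ A B] (π : F) {s x : A} {κ : ℂ} (h : SkewComm s x κ) :
    SkewComm (π s) (π x) κ := by
  unfold SkewComm at *
  rw [← map_mul, h, map_smul, map_mul]

/-! ### Bounding homogeneous components in a representation with γ ≠ 0 -/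

namespace SUqTheta

section Representation

variable {q θ : ℝ} {B : Type*} [CStarAlgebra B] (π : Pol q θ →⋆ₐ[ℂ] B)

theorem star_gen_c : star (gen q θ .c) = gen q θ .cStar := star_gen _

theorem star_map_c_mul_map_c : star (π (gen q θ .c)) * π (gen q θ .c) = π (modSq q θ) := by
  rw [← map_star, star_gen_c, ← map_mul, r_cc, modSq]

theorem map_c_mul_star_map_c : π (gen q θ .c) * star (π (gen q θ .c)) = π (modSq q θ) := by
  rw [← map_star, star_gen_c, ← map_mul, modSq]

theorem isSelfAdjoint_map_modSq : IsSelfAdjoint (π (modSq q θ)) := by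
  rw [IsSelfAdjoint, ← map_star, star_modSq]

variable (hq : q ≠ 0) (hq1 : -1 < q) (hq2 : q < 1) (hc : π (gen q θ .c) ≠ 0)
include hq hq1 hq2 hc

theorem spectrum_map_modSq : spectrum ℂ (π (modSq q θ)) = geomSpectrum q := by
  refine spectrum_eq_of_quantumDisc (a := π (gen q θ .a)) hq hq1 hq2 ?_ ?_
    ⟨_, (star_map_c_mul_map_c π).symm⟩ ?_
  · rw [← map_star, star_gen, adj, ← map_mul, r_aStara, map_sub, map_one, modSq]
  · rw [← map_star, star_gen, adj, ← map_mul, r_aaStar, map_sub, map_one, map_smul, modSq]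
  · rw [← star_map_c_mul_map_c]
    exact (CStarRing.star_mul_self_ne_zero_iff _).2 hc

/-- The norm of an element of degree `g` is determined by its modulus. -/
theorem norm_map_sq_le {x : Pol q θ} {P : ℂ[X]} (h : star x * x = aeval (modSq q θ) P) {C : ℝ}
    (hC : ∀ n : ℕ, ‖P.eval (((q : ℂ) ^ 2) ^ n)‖ ≤ C) : ‖π x‖ ^ 2 ≤ C := by
  have : Nontrivial B := ⟨_, _, hc⟩
  rw [sq, ← CStarRing.norm_star_mul_self, ← map_star, ← map_mul, h, ← StarAlgHom.coe_toAlgHom,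
    ← Polynomial.aeval_algHom_apply]
  refine norm_aeval_le_of_forall_mem_spectrum (isSelfAdjoint_map_modSq π) fun z hz => ?_
  replace hz : z ∈ spectrum ℂ (π (modSq q θ)) := hz
  rw [spectrum_map_modSq π hq hq1 hq2 hc] at hz
  rcases hz with rfl | ⟨n, rfl⟩
  -- The point 0 is the limit of the q^(2n), so the bound extends to it by continuity.
  · have : Filter.Tendsto (fun n : ℕ => ((q : ℂ) ^ 2) ^ n) Filter.atTop (nhds 0) := by
      refine tendsto_pow_atTop_nhds_zero_of_norm_lt_one ?_
      rw [norm_pow, Complex.norm_real, Real.norm_eq_abs, sq_abs]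
      nlinarith
    exact le_of_tendsto ((P.continuous.tendsto 0).comp this).norm (.of_forall hC)
  · exact hC n

theorem norm_eval_le_norm_map_sq {x : Pol q θ} {P : ℂ[X]} (h : star x * x = aeval (modSq q θ) P)
    (n : ℕ) : ‖P.eval (((q : ℂ) ^ 2) ^ n)‖ ≤ ‖π x‖ ^ 2 := by
  have : Nontrivial B := ⟨_, _, hc⟩
  rw [pow_two ‖π x‖, ← CStarRing.norm_star_mul_self, ← map_star, ← map_mul, h,
    ← StarAlgHom.coe_toAlgHom, ← Polynomial.aeval_algHom_apply]
  refine norm_eval_le_norm_aeval _ _ ?_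
  change _ ∈ spectrum ℂ (π (modSq q θ))
  rw [spectrum_map_modSq π hq hq1 hq2 hc]
  exact Or.inr ⟨n, rfl⟩

omit hq hq1 hq2 hc in
-- Conjugation by the unitary π(u)^k is isometric and multiplies the component of degree (i, l, m)
-- by the k-th power of a unimodular scalar depending only on l; averaging over k isolates one value
-- of the scalar.
theorem norm_map_sum_filter_le (S : Finset (ℤ × ℤ × ℤ)) {y : ℤ × ℤ × ℤ → Pol q θ}
    (hy : ∀ g ∈ S, y g ∈ homog q θ g) (g₀ : ℤ × ℤ × ℤ) :
    ‖π (∑ g ∈ S with (phase θ)⁻¹ ^ g.2.1 = (phase θ)⁻¹ ^ g₀.2.1, y g)‖ ≤ ‖π (∑ g ∈ S, y g)‖ := by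
  have hn : ∀ l : ℤ, ‖(phase θ)⁻¹ ^ l‖ = 1 := fun l => by simp [norm_phase]
  rw [map_sum]
  refine norm_sum_filter_le_of_forall_pow S (fun g => (phase θ)⁻¹ ^ g.2.1) (fun g => π (y g))
    (fun g _ => hn _) (fun k => ?_) (hn _)
  have hu : star (π (gen q θ .u)) * π (gen q θ .u) = 1 := by
    rw [← map_star, star_gen, adj, ← map_mul, r_uStaru, map_one]
  have hu' : π (gen q θ .u) * star (π (gen q θ .u)) = 1 := by
    rw [← map_star, star_gen, adj, ← map_mul, r_uuStar, map_one]
  let U : unitary B := ⟨π (gen q θ .u), Unitary.mem_iff.2 ⟨hu, hu'⟩⟩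
  have key : ∑ g ∈ S, ((phase θ)⁻¹ ^ g.2.1) ^ k • π (y g) =
      (U ^ k : unitary B) * π (∑ g ∈ S, y g) * (star (U ^ k) : unitary B) := by
    rw [map_sum, Finset.mul_sum, Finset.sum_mul]
    refine Finset.sum_congr rfl fun g hg => ?_
    have : SkewComm ((U ^ k : unitary B) : B) (π (y g)) (((phase θ)⁻¹ ^ g.2.1) ^ k) := by
      rw [SubmonoidClass.coe_pow]
      have h := (skew_u_of_mem_homog (hy g hg)).map π
      induction k with
      | zero => simp [SkewComm]
      | succ k ih => rw [pow_succ, pow_succ]; exact ih.mul_left h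
    rw [this, smul_mul_assoc, mul_assoc, Unitary.coe_mul_star_self, mul_one]
  rw [key, CStarRing.norm_mul_coe_unitary, CStarRing.norm_coe_unitary_mul]

omit hq2 hq1 hc in
-- Multiplication by t acts on π(y g) p as the scalar q^(-2i) s. Terms with different scalars have
-- orthogonal ranges, t being selfadjoint, so discarding some of them cannot increase the norm.
theorem norm_eigen_sum_le (S : Finset (ℤ × ℤ × ℤ)) {y : ℤ × ℤ × ℤ → Pol q θ}
    (hy : ∀ g ∈ S, y g ∈ homog q θ g) (i : ℤ) {p : B} {s : ℝ} (hs : s ≠ 0)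
    (hp : π (modSq q θ) * p = (s : ℂ) • p) :
    ‖∑ g ∈ S with ((q ^ 2)⁻¹) ^ g.1 = ((q ^ 2)⁻¹) ^ i, π (y g) * p‖ ≤
      ‖∑ g ∈ S, π (y g) * p‖ := by
  set t := π (modSq q θ)
  have ht : star t = t := isSelfAdjoint_map_modSq π
  have heig : ∀ g ∈ S, t * (π (y g) * p) = ((((q ^ 2)⁻¹) ^ g.1 * s : ℝ) : ℂ) • (π (y g) * p) := by
    intro g hg
    have h := (skew_modSq_of_mem_homog hq (hy g hg)).map π
    rw [SkewComm] at h
    rw [← mul_assoc, h, smul_mul_assoc, mul_assoc, hp, mul_smul_comm, smul_smul]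
    push_cast
    rfl
  rw [← Finset.sum_filter_add_sum_filter_not S (fun g => ((q ^ 2)⁻¹) ^ g.1 = ((q ^ 2)⁻¹) ^ i)
    (fun g => π (y g) * p)]
  refine norm_le_norm_add_of_star_mul_eq_zero ?_
  rw [star_sum, Finset.sum_mul_sum]
  refine Finset.sum_eq_zero fun g hg => Finset.sum_eq_zero fun h hh => ?_
  rw [Finset.mem_filter] at hg hh
  set a : ℝ := ((q ^ 2)⁻¹) ^ g.1 * s
  set b : ℝ := ((q ^ 2)⁻¹) ^ h.1 * s
  have hab : (b : ℂ) - a ≠ 0 := by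
    rw [sub_ne_zero]
    intro e
    have e' : b = a := by exact_mod_cast e
    exact hh.2 ((mul_right_cancel₀ hs e').trans hg.2)
  have h1 : (b : ℂ) • (star (π (y g) * p) * (π (y h) * p)) =
      (a : ℂ) • (star (π (y g) * p) * (π (y h) * p)) := by
    rw [← mul_smul_comm, ← heig h hh.1, ← mul_assoc]
    nth_rw 1 [← ht]
    rw [← star_mul, heig g hg.1, star_smul, smul_mul_assoc, Complex.star_def, Complex.conj_ofReal]
  rw [← sub_eq_zero, ← sub_smul] at h1
  exact (smul_eq_zero.1 h1).resolve_left hab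

omit hq1 hq2 hc in
-- With i and l fixed, R ↦ γRγ* multiplies the g-th term by s κ(g), while the norm of the sum is
-- multiplied by exactly r s with r = |κ(g)| the same for all g. After normalisation the averaging
-- lemma applies, and the ratios κ(g)/κ(g₀) separate m.
theorem norm_map_mul_eigen_le (hθ : Irrational θ) (S : Finset (ℤ × ℤ × ℤ))
    {y : ℤ × ℤ × ℤ → Pol q θ} (hy : ∀ g ∈ S, y g ∈ homog q θ g) {g₀ : ℤ × ℤ × ℤ} (hg₀ : g₀ ∈ S)
    (hS : ∀ g ∈ S, g.1 = g₀.1 ∧ g.2.1 = g₀.2.1) {p : B} {s : ℝ} (hs : 0 < s)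
    (hp : π (modSq q θ) * p = (s : ℂ) • p) (hp' : p * π (modSq q θ) = (s : ℂ) • p)
    (hpc : Commute p (π (gen q θ .c))) :
    ‖π (y g₀) * p‖ ≤ ‖∑ g ∈ S, π (y g) * p‖ := by
  set t := π (modSq q θ)
  set κ : ℤ × ℤ × ℤ → ℂ := fun g => phase θ ^ g.2.2 * (q : ℂ)⁻¹ ^ g.1 with hκ
  have hq' : (q : ℂ) ≠ 0 := by exact_mod_cast hq
  have hκ0 : ∀ g, κ g ≠ 0 := fun g =>
    mul_ne_zero (zpow_ne_zero _ phase_ne) (zpow_ne_zero _ (inv_ne_zero hq'))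
  set r : ℝ := ‖κ g₀‖ with hr
  have hrpos : 0 < r := norm_pos_iff.2 (hκ0 _)
  have hκn : ∀ g ∈ S, ‖κ g‖ = r := fun g hg => by
    simp only [hr, hκ, norm_mul, norm_zpow, norm_phase, one_zpow, (hS g hg).1]
  have hr2 : r ^ 2 = ((q ^ 2)⁻¹) ^ g₀.1 := by
    rw [hr, hκ]
    simp only [norm_mul, norm_zpow, norm_phase, one_zpow, norm_inv, Complex.norm_real, one_mul]
    rw [← zpow_natCast, ← zpow_mul, mul_comm, zpow_mul, zpow_natCast, inv_pow, Real.norm_eq_abs,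
      sq_abs]
  set R : ℕ → B := fun k => ∑ g ∈ S, κ g ^ k • (π (y g) * p) with hR
  have hRl : ∀ k, t * R k = ((r ^ 2 * s : ℝ) : ℂ) • R k := by
    intro k
    rw [hR, Finset.mul_sum, Finset.smul_sum]
    refine Finset.sum_congr rfl fun g hg => ?_
    have h := (skew_modSq_of_mem_homog hq (hy g hg)).map π
    rw [SkewComm] at h
    rw [mul_smul_comm, smul_comm, ← mul_assoc, h, smul_mul_assoc, mul_assoc, hp, mul_smul_comm,
      (hS g hg).1, hr2]
    simp only [smul_smul]
    congr 1
    push_cast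
    ring
  have hRr : ∀ k, R k * t = (s : ℂ) • R k := by
    intro k
    rw [hR, Finset.sum_mul, Finset.smul_sum]
    refine Finset.sum_congr rfl fun g hg => ?_
    rw [smul_mul_assoc, mul_assoc, hp', mul_smul_comm, smul_comm]
  -- Moving γ to the right past π(y g) gives κ(g), and past p nothing; it then meets γ*, and p γγ* =
  -- s p.
  have hstep : ∀ k, π (gen q θ .c) * R k * star (π (gen q θ .c)) = (s : ℂ) • R (k + 1) := by
    intro k
    simp only [hR]
    rw [Finset.mul_sum, Finset.sum_mul, Finset.smul_sum]
    refine Finset.sum_congr rfl fun g hg => ?_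
    have h := (skew_c_of_mem_homog hq (hy g hg)).map π
    rw [SkewComm] at h
    rw [mul_smul_comm, ← mul_assoc, h, smul_mul_assoc, smul_mul_assoc, smul_mul_assoc,
      mul_assoc (π (y g)), ← hpc.eq, mul_assoc, mul_assoc p, map_c_mul_star_map_c, hp',
      mul_smul_comm, smul_smul, smul_smul, smul_smul, pow_succ]
    congr 1
    simp only [hκ]
    ring
  have hnorm : ∀ k, ‖R k‖ = r ^ k * ‖R 0‖ := by
    intro k
    induction k with
    | zero => simp
    | succ k ih =>
      have h := norm_mul_mul_star_of_eigen hrpos.le hs.le (star_map_c_mul_map_c π) (hRl k) (hRr k)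
      rw [hstep, norm_smul, Complex.norm_real, Real.norm_of_nonneg hs.le, ih] at h
      rw [pow_succ]
      apply mul_left_cancel₀ hs.ne'
      rw [h]; ring
  have hR0 : R 0 = ∑ g ∈ S, π (y g) * p := by simp [hR]
  have main := norm_sum_filter_le_of_forall_pow S (fun g => κ g / κ g₀) (fun g => π (y g) * p)
    (C := ‖R 0‖) (fun g hg => by rw [norm_div, hκn g hg]; exact div_self hrpos.ne')
    (fun k => by
      have e : ∑ g ∈ S, (κ g / κ g₀) ^ k • (π (y g) * p) = (κ g₀ ^ k)⁻¹ • R k := by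
        simp only [hR, Finset.smul_sum, smul_smul]
        refine Finset.sum_congr rfl fun g _ => ?_
        rw [div_pow, div_eq_inv_mul]
      rw [e, norm_smul, norm_inv, norm_pow, hnorm, inv_mul_cancel_left₀ (pow_ne_zero _ hrpos.ne')])
    (z := 1) norm_one
  -- Equal κ with equal i means equal powers of exp(2πiθ), hence equal m by irrationality.
  have hfil : (S.filter fun g => κ g / κ g₀ = 1) = {g₀} := by
    ext g
    simp only [Finset.mem_filter, Finset.mem_singleton, div_eq_one_iff_eq (hκ0 g₀)]
    refine ⟨fun ⟨hg, h⟩ => ?_, by rintro rfl; exact ⟨hg₀, rfl⟩⟩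
    simp only [hκ, (hS g hg).1] at h
    have h2 := phase_zpow_injective hθ
      (mul_right_cancel₀ (zpow_ne_zero _ (inv_ne_zero hq')) h)
    exact Prod.ext (hS g hg).1 (Prod.ext (hS g hg).2 h2)
  rw [hfil, Finset.sum_singleton, hR0] at main
  exact main

/-- In a representation with `γ ≠ 0` the homogeneous components of an element are bounded by the
element. -/
theorem norm_map_component_le (hθ : Irrational θ) (S : Finset (ℤ × ℤ × ℤ))
    {y : ℤ × ℤ × ℤ → Pol q θ} (hy : ∀ g ∈ S, y g ∈ homog q θ g) {g₀ : ℤ × ℤ × ℤ} (hg₀ : g₀ ∈ S) :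
    ‖π (y g₀)‖ ≤ ‖π (∑ g ∈ S, y g)‖ := by
  have : Nontrivial B := ⟨_, _, hc⟩
  obtain ⟨P, hP, -⟩ := exists_modulus_of_mem_homog hq (hy g₀ hg₀)
  refine (sq_le_sq₀ (norm_nonneg _) (norm_nonneg _)).1
    (norm_map_sq_le π hq hq1 hq2 hc hP fun n => ?_)
  obtain ⟨p, hp, hp1, hpt, hpcomm⟩ := exists_eigenelement hq hq1 hq2 (isSelfAdjoint_map_modSq π)
    (spectrum_map_modSq π hq hq1 hq2 hc) n
  set s : ℝ := (q ^ 2) ^ n with hs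
  have hs0 : 0 < s := by positivity
  have hsC : ((q : ℂ) ^ 2) ^ n = s := by rw [hs]; push_cast; rfl
  rw [hsC] at hpt ⊢
  have hpt' : p * π (modSq q θ) = (s : ℂ) • p := by
    rw [(hpcomm _ (Commute.refl _)).eq, hpt]
  have hpc : Commute p (π (gen q θ .c)) := by
    refine hpcomm _ ?_
    have := (skew_modSq_c (q := q) (θ := θ)).map π
    rwa [SkewComm, one_smul] at this
  -- (π(y)p)*(π(y)p) = p P(t) p = P(s) p², and p² = p*p has norm one.
  have hz : ‖π (y g₀) * p‖ ^ 2 = ‖P.eval (s : ℂ)‖ := by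
    rw [sq, ← CStarRing.norm_star_mul_self, star_mul, mul_assoc, ← mul_assoc (star (π (y g₀))),
      ← map_star, ← map_mul, hP, ← StarAlgHom.coe_toAlgHom, ← Polynomial.aeval_algHom_apply,
      StarAlgHom.coe_toAlgHom, aeval_mul_of_eigen hpt, mul_smul_comm, norm_smul,
      CStarRing.norm_star_mul_self, hp1]
    simp
  rw [← hz]
  refine pow_le_pow_left₀ (norm_nonneg _) ?_ 2
  have hr1 : q ^ 2 < 1 := by nlinarith
  have hl : Function.Injective fun m : ℤ => (phase θ)⁻¹ ^ m := by
    intro m n h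
    refine neg_injective (phase_zpow_injective hθ ?_)
    simpa only [zpow_neg, ← inv_zpow] using h
  have hi : Function.Injective fun m : ℤ => ((q ^ 2)⁻¹) ^ m :=
    zpow_right_injective₀ (by positivity) (by
      intro h
      rw [inv_eq_one] at h
      exact hr1.ne h)
  set S₁ := S.filter fun g => (phase θ)⁻¹ ^ g.2.1 = (phase θ)⁻¹ ^ g₀.2.1 with hS₁
  set S₂ := S₁.filter fun g => ((q ^ 2)⁻¹) ^ g.1 = ((q ^ 2)⁻¹) ^ g₀.1 with hS₂
  have hy₁ : ∀ g ∈ S₁, y g ∈ homog q θ g := fun g hg => hy g (Finset.mem_filter.1 hg).1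
  have hy₂ : ∀ g ∈ S₂, y g ∈ homog q θ g := fun g hg => hy₁ g (Finset.mem_filter.1 hg).1
  -- Read upwards: restrict to the value of l, cut down by p, restrict to the value of i, and
  -- finally single out m.
  calc ‖π (y g₀) * p‖ ≤ ‖∑ g ∈ S₂, π (y g) * p‖ :=
        norm_map_mul_eigen_le π hq hθ S₂ hy₂ (by simp [hS₂, hS₁, hg₀])
          (fun g hg => by
            simp only [hS₂, hS₁, Finset.mem_filter] at hg
            exact ⟨hi hg.2, hl hg.1.2⟩) hs0 hpt hpt' hpc
    _ ≤ ‖∑ g ∈ S₁, π (y g) * p‖ := norm_eigen_sum_le π hq S₁ hy₁ g₀.1 hs0.ne' hpt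
    _ = ‖π (∑ g ∈ S₁, y g) * p‖ := by rw [map_sum, Finset.sum_mul]
    _ ≤ ‖π (∑ g ∈ S₁, y g)‖ := (norm_mul_le _ _).trans (by rw [hp1, mul_one])
    _ ≤ _ := norm_map_sum_filter_le π S hy g₀

end Representation

end SUqTheta


/-! ### Comparison of two representations, and faithfulness -/

theorem le_of_forall_pow_two_pow_le {a b : ℝ} (hb : 0 ≤ b) (D : ℕ)
    (h : ∀ k : ℕ, a ^ 2 ^ k ≤ ((2 * (D * 2 ^ k) + 1) ^ 3 : ℕ) * b ^ 2 ^ k) : a ≤ b := by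
  by_contra! hab
  rcases hb.eq_or_lt with rfl | hb
  · have := h 0
    simp at this
    linarith
  have hr : 1 < a / b := (one_lt_div hb).2 hab
  -- If b < a, the ratio (a/b)^(2^k) would outgrow the cubic factor in 2^k.
  have hlim : Filter.Tendsto
      (fun k : ℕ => ((2 * D + 1 : ℕ) : ℝ) ^ 3 * ((((2 ^ k : ℕ) : ℝ)) ^ 3 / (a / b) ^ 2 ^ k))
      Filter.atTop (nhds 0) := by
    have h1 := (tendsto_pow_const_div_const_pow_of_one_lt 3 hr).comp
      (tendsto_pow_atTop_atTop_of_one_lt (r := (2 : ℕ)) one_lt_two)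
    simpa using h1.const_mul (((2 * D + 1 : ℕ) : ℝ) ^ 3)
  have : (1 : ℝ) ≤ 0 := by
    refine ge_of_tendsto' hlim fun k => ?_
    have hpos : 0 < (a / b) ^ 2 ^ k := by positivity
    rw [← mul_div_assoc, one_le_div hpos, div_pow, div_le_iff₀ (by positivity)]
    refine (h k).trans ?_
    gcongr
    rw [← mul_pow]
    norm_cast
    gcongr
    -- This gives 2D·2^k + 1 ≤ (2D + 1)·2^k.
    have : 1 ≤ 2 ^ k := Nat.one_le_two_pow
    nlinarith
  linarith

namespace SUqTheta

section Comparison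

variable {q θ : ℝ} {B B' : Type*} [CStarAlgebra B] [CStarAlgebra B'] (π : Pol q θ →⋆ₐ[ℂ] B)
  (π' : Pol q θ →⋆ₐ[ℂ] B')
  (hq : q ≠ 0) (hq1 : -1 < q) (hq2 : q < 1) (hθ : Irrational θ)
  (hc : π (gen q θ .c) ≠ 0) (hc' : π' (gen q θ .c) ≠ 0)
include hq hq1 hq2 hθ hc hc'

omit hθ in
-- Both squared norms are the supremum of |P| over the same points q^(2n).
theorem norm_map_le_of_mem_homog {g : ℤ × ℤ × ℤ} {x : Pol q θ} (hx : x ∈ homog q θ g) :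
    ‖π x‖ ≤ ‖π' x‖ := by
  obtain ⟨P, hP, -⟩ := exists_modulus_of_mem_homog hq hx
  exact (sq_le_sq₀ (norm_nonneg _) (norm_nonneg _)).1 (norm_map_sq_le π hq hq1 hq2 hc hP
    (norm_eval_le_norm_map_sq π' hq hq1 hq2 hc' hP))

theorem norm_map_le_of_mem_genSpan_pow {d : ℕ} {x : Pol q θ} (hx : x ∈ genSpan q θ ^ d) :
    ‖π x‖ ≤ ((2 * d + 1) ^ 3 : ℕ) * ‖π' x‖ := by
  obtain ⟨y, hy, rfl⟩ := exists_homog_decomposition hq hx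
  calc ‖π (∑ g ∈ box d, y g)‖ ≤ ∑ g ∈ box d, ‖π (y g)‖ := by
        rw [map_sum]; exact norm_sum_le _ _
    _ ≤ ∑ g ∈ box d, ‖π' (∑ g ∈ box d, y g)‖ := Finset.sum_le_sum fun g hg =>
        (norm_map_le_of_mem_homog π π' hq hq1 hq2 hc hc' (hy g)).trans
          (norm_map_component_le π' hq hq1 hq2 hc' hθ _ (fun g _ => hy g) hg)
    _ = _ := by rw [Finset.sum_const, card_box, nsmul_eq_mul]

omit hq hq1 hq2 hθ hc hc' in
theorem norm_map_pow_two_pow {y : Pol q θ} (hy : IsSelfAdjoint y) (k : ℕ) :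
    ‖π (y ^ 2 ^ k)‖ = ‖π y‖ ^ 2 ^ k := by
  rw [map_pow]
  exact congrArg NNReal.toReal ((hy.map π).nnnorm_pow_two_pow k)

/-- Any two representations with `γ ≠ 0` induce the same norm. -/
theorem norm_map_le (x : Pol q θ) : ‖π x‖ ≤ ‖π' x‖ := by
  -- For selfadjoint y the norm of y^(2^k) is the 2^k-th power of the norm of y, while its word
  -- length is only D·2^k; the factor lost in decomposing it is thus cubic in 2^k.
  set y := star x * x with hy
  obtain ⟨D, hD⟩ := exists_mem_genSpan_pow y
  have hsa : IsSelfAdjoint y := .star_mul_self x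
  have main : ‖π y‖ ≤ ‖π' y‖ := by
    refine le_of_forall_pow_two_pow_le (norm_nonneg _) D fun k => ?_
    rw [← norm_map_pow_two_pow π hsa, ← norm_map_pow_two_pow π' hsa]
    refine norm_map_le_of_mem_genSpan_pow π π' hq hq1 hq2 hθ hc hc' ?_
    rw [pow_mul]
    exact Submodule.pow_mem_pow _ hD _
  rw [hy, map_mul, map_mul, map_star, map_star, CStarRing.norm_star_mul_self,
    CStarRing.norm_star_mul_self] at main
  exact (mul_self_le_mul_self_iff (norm_nonneg _) (norm_nonneg _)).2 main

omit hc' in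
/-- A representation with `γ ≠ 0` is faithful. -/
theorem eq_zero_of_map_eq_zero {x : Pol q θ} (hx : π x = 0) : x = 0 := by
  obtain ⟨d, hd⟩ := exists_mem_genSpan_pow x
  obtain ⟨y, hy, rfl⟩ := exists_homog_decomposition hq hd
  refine Finset.sum_eq_zero fun g hg => ?_
  obtain ⟨P, hP, h⟩ := exists_modulus_of_mem_homog hq (hy g)
  have h0 : ‖π (y g)‖ = 0 := by
    refine le_antisymm ?_ (norm_nonneg _)
    rw [← norm_zero (E := B), ← hx]
    exact norm_map_component_le π hq hq1 hq2 hc hθ _ (fun g _ => hy g) hg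
  -- The component has norm zero in π, so P vanishes at the infinitely many points q^(2n).
  refine h (Polynomial.eq_zero_of_infinite_isRoot P ?_)
  have hinj : Function.Injective fun n : ℕ => ((q : ℂ) ^ 2) ^ n := by
    intro m n hmn
    replace hmn : ((q : ℂ) ^ 2) ^ m = ((q : ℂ) ^ 2) ^ n := hmn
    have hmn' : (q ^ 2) ^ m = (q ^ 2) ^ n := by exact_mod_cast hmn
    exact (pow_right_strictAnti₀ (by positivity : 0 < q ^ 2) (by nlinarith)).injective hmn'
  refine (Set.infinite_range_of_injective hinj).mono ?_
  rintro _ ⟨n, rfl⟩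
  have := norm_eval_le_norm_map_sq π hq hq1 hq2 hc hP n
  rw [h0] at this
  simpa [IsRoot] using this

end Comparison

end SUqTheta



/-! ### C*-completion of a pre-C*-norm -/

section Completion

open UniformSpace

variable {A : Type u} [NormedRing A] [StarRing A] [CStarRing A]

/-- The extension of the involution to the completion. -/
noncomputable abbrev completionStar : Star (Completion A) := ⟨Completion.map star⟩

attribute [local instance] completionStar

theorem completion_star_coe (x : A) : star (x : Completion A) = ((star x : A) : Completion A) :=
  Completion.map_coe star_isometry.uniformContinuous x

omit [CStarRing A] in
theorem completion_continuous_star : Continuous (star : Completion A → Completion A) :=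
  Completion.continuous_map

/-- The completion of a normed *-ring with the C*-identity is a *-ring. -/
noncomputable abbrev completionStarRing : StarRing (Completion A) where
  star_involutive x := by
    induction x using Completion.induction_on with
    | hp =>
      exact isClosed_eq (f := fun x : Completion A => star (star x))
        (completion_continuous_star.comp completion_continuous_star) continuous_id
    | ih x => rw [completion_star_coe, completion_star_coe, star_star]
  star_mul x y := by
    induction x, y using Completion.induction_on₂ with
    | hp =>
      exact isClosed_eq (completion_continuous_star.comp (by fun_prop))
        ((completion_continuous_star.comp continuous_snd).mul
          (completion_continuous_star.comp continuous_fst))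
    | ih x y => simp only [completion_star_coe, ← Completion.coe_mul, star_mul]
  star_add x y := by
    induction x, y using Completion.induction_on₂ with
    | hp =>
      exact isClosed_eq (completion_continuous_star.comp (by fun_prop))
        ((completion_continuous_star.comp continuous_fst).add
          (completion_continuous_star.comp continuous_snd))
    | ih x y => simp only [completion_star_coe, ← Completion.coe_add, star_add]

attribute [local instance] completionStarRing

theorem completion_cstarRing : CStarRing (Completion A) where
  norm_mul_self_le x := by
    induction x using Completion.induction_on with
    | hp =>
      exact isClosed_le (by fun_prop) ((completion_continuous_star.mul continuous_id).norm)
    | ih x =>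
      rw [completion_star_coe, ← Completion.coe_mul, Completion.norm_coe, Completion.norm_coe,
        CStarRing.norm_star_mul_self]

variable [NormedAlgebra ℂ A] [StarModule ℂ A]

/-- The completion of a normed algebra is a normed algebra. -/
noncomputable abbrev completionNormedAlgebra : NormedAlgebra ℂ (Completion A) where
  norm_smul_le := norm_smul_le

theorem completion_starModule : StarModule ℂ (Completion A) where
  star_smul r x := by
    induction x using Completion.induction_on with
    | hp =>
      exact isClosed_eq (f := fun x : Completion A => star (r • x))
        (completion_continuous_star.comp (continuous_const_smul r))
        ((continuous_const_smul (star r)).comp completion_continuous_star)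
    | ih x =>
      rw [← Completion.coe_smul, completion_star_coe, completion_star_coe, star_smul,
        Completion.coe_smul]

/-- The completion of a normed *-algebra with the C*-identity. -/
noncomputable abbrev completionCStarAlgebra : CStarAlgebra (Completion A) where
  __ := (inferInstance : NormedRing (Completion A))
  __ := (inferInstance : CompleteSpace (Completion A))
  __ := completionStarRing
  __ := completionNormedAlgebra
  __ := completion_cstarRing
  __ := completion_starModule

theorem exists_starAlgHom_cstarAlgebra :
    ∃ (B : Type u) (_ : CStarAlgebra B) (π : A →⋆ₐ[ℂ] B), ∀ x, ‖π x‖ = ‖x‖ :=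
  ⟨Completion A, completionCStarAlgebra,
    { toFun := fun x => (x : Completion A)
      map_one' := Completion.coe_one A
      map_mul' := fun x y => Completion.coe_mul x y
      map_zero' := Completion.coe_zero
      map_add' := fun x y => Completion.coe_add x y
      commutes' := fun _ => rfl
      map_star' := fun x => (completion_star_coe x).symm }, fun x => Completion.norm_coe x⟩

end Completion

/-- A pre-C*-norm is induced by a homomorphism to a C*-algebra. -/
theorem exists_starAlgHom_of_isPreCStarNorm {A : Type u} [Ring A] [StarRing A] [Algebra ℂ A]
    [StarModule ℂ A] {N : AlgebraNorm ℂ A} (hN : DiscreteQuantumGroup.IsPreCStarNorm N) :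
    ∃ (B : Type u) (_ : CStarAlgebra B) (π : A →⋆ₐ[ℂ] B), ∀ x, ‖π x‖ = N x := by
  let _ : NormedRing A := N.toRingNorm.toNormedRing
  have hnorm : ∀ x : A, ‖x‖ = N x := fun _ => rfl
  let _ : NormedAlgebra ℂ A := { norm_smul_le := fun r x => (map_smul_eq_mul N r x).le }
  have : CStarRing A := ⟨fun x => by rw [hnorm, hnorm, hN, sq]⟩
  exact exists_starAlgHom_cstarAlgebra (A := A)


/-! ### Weighted composition operators on ℓ² -/

section WeightedComposition

variable {I : Type*}

theorem norm_sq_eq_tsum (f : lp (fun _ : I => ℂ) 2) : ‖f‖ ^ 2 = ∑' i, ‖f i‖ ^ 2 := by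
  simpa using lp.norm_rpow_eq_tsum (p := 2) (by simp) f

theorem summable_norm_sq (f : lp (fun _ : I => ℂ) 2) : Summable fun i => ‖f i‖ ^ 2 := by
  simpa using (lp.memℓp f).summable (by simp)

variable (σ : I → I) (hσ : Function.Injective σ) (w : I → ℂ) (hw : ∀ i, ‖w i‖ ≤ 1)

include hσ hw in
theorem summable_weightedComp (f : lp (fun _ : I => ℂ) 2) :
    Summable fun i => ‖w i * f (σ i)‖ ^ 2 := by
  refine Summable.of_nonneg_of_le (fun i => by positivity) (fun i => ?_)
    ((summable_norm_sq f).comp_injective hσ)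
  rw [norm_mul]
  exact pow_le_pow_left₀ (by positivity) (mul_le_of_le_one_left (norm_nonneg _) (hw i)) 2

/-- The operator `f ↦ w · (f ∘ σ)` on `ℓ²`. -/
noncomputable def weightedComp : lp (fun _ : I => ℂ) 2 →L[ℂ] lp (fun _ : I => ℂ) 2 :=
  LinearMap.mkContinuous
    { toFun := fun f => ⟨fun i => w i * f (σ i), memℓp_gen (by
        simpa using summable_weightedComp σ hσ w hw f)⟩
      map_add' := fun f g => by ext i; exact mul_add _ _ _
      map_smul' := fun r f => by ext i; simp [mul_left_comm] }
    1 fun f => by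
      rw [one_mul, ← sq_le_sq₀ (norm_nonneg _) (norm_nonneg _), norm_sq_eq_tsum, norm_sq_eq_tsum]
      refine le_trans ?_ (tsum_comp_le_tsum_of_inj (summable_norm_sq f) (fun i => by positivity) hσ)
      refine Summable.tsum_le_tsum (fun i => ?_) (summable_weightedComp σ hσ w hw f)
        ((summable_norm_sq f).comp_injective hσ)
      change ‖w i * f (σ i)‖ ^ 2 ≤ _
      rw [norm_mul]
      exact pow_le_pow_left₀ (by positivity) (mul_le_of_le_one_left (norm_nonneg _) (hw i)) 2

theorem weightedComp_apply (f : lp (fun _ : I => ℂ) 2) (i : I) :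
    weightedComp σ hσ w hw f i = w i * f (σ i) := rfl

theorem star_apply_eq_inner [DecidableEq I]
    (T : lp (fun _ : I => ℂ) 2 →L[ℂ] lp (fun _ : I => ℂ) 2)
    (f : lp (fun _ : I => ℂ) 2) (i : I) :
    star T f i = inner ℂ (T (lp.single 2 i 1)) f := by
  have h := lp.inner_single_left (𝕜 := ℂ) (G := fun _ : I => ℂ) i 1 (star T f)
  rw [ContinuousLinearMap.star_eq_adjoint, ContinuousLinearMap.adjoint_inner_right] at h
  rw [ContinuousLinearMap.star_eq_adjoint, h]
  simp

/-- The adjoint is read off from basis vectors: the operator sends the one at σ i to w i times the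
one at i, and kills those outside the range of σ. -/
theorem star_weightedComp_apply (f : lp (fun _ : I => ℂ) 2) (i : I) :
    star (weightedComp σ hσ w hw) f (σ i) = conj (w i) * f i := by
  classical
  rw [star_apply_eq_inner]
  have : weightedComp σ hσ w hw (lp.single 2 (σ i) 1) = lp.single 2 i (w i) := by
    ext j
    rw [weightedComp_apply, lp.single_apply, lp.single_apply]
    by_cases h : j = i
    · subst h; simp
    · simp [Pi.single_eq_of_ne h, Pi.single_eq_of_ne (hσ.ne h)]
  rw [this, lp.inner_single_left]
  simp [mul_comm]

theorem star_weightedComp_apply_of_notMem (f : lp (fun _ : I => ℂ) 2) {i : I}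
    (hi : ∀ j, σ j ≠ i) : star (weightedComp σ hσ w hw) f i = 0 := by
  classical
  rw [star_apply_eq_inner]
  have : weightedComp σ hσ w hw (lp.single 2 i 1) = 0 := by
    ext j
    rw [weightedComp_apply, lp.single_apply]
    simp [Pi.single_eq_of_ne (hi j)]
  rw [this, inner_zero_left]

end WeightedComposition

/-! ### The representation on ℓ²(ℕ × ℤ) -/

namespace SUqTheta

section ConcreteRepresentation

/-- The Hilbert space `ℓ²(ℕ × ℤ)`. -/
abbrev RepSpace : Type := lp (fun _ : ℕ × ℤ => ℂ) 2

variable (q θ : ℝ) (hq1 : -1 < q) (hq2 : q < 1)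

/-- The weights of `α`. -/
noncomputable def aWeight (n : ℕ) : ℝ := √(1 - (q ^ 2) ^ (n + 1))

include hq1 hq2 in
theorem sq_pow_le_one (n : ℕ) : (q ^ 2) ^ n ≤ 1 :=
  pow_le_one₀ (sq_nonneg q) (by nlinarith)

include hq1 hq2 in
theorem aWeight_mul_self (n : ℕ) :
    (aWeight q n : ℂ) * aWeight q n = 1 - ((q : ℂ) ^ 2) ^ (n + 1) := by
  have : aWeight q n * aWeight q n = 1 - (q ^ 2) ^ (n + 1) :=
    Real.mul_self_sqrt (sub_nonneg.2 (sq_pow_le_one q hq1 hq2 _))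
  exact_mod_cast this

/-- The operator representing `α`. -/
noncomputable def aOp : RepSpace →L[ℂ] RepSpace :=
  weightedComp (fun x : ℕ × ℤ => (x.1 + 1, x.2))
    (fun x y h => by
      simp only [Prod.mk.injEq, add_left_inj] at h
      exact Prod.ext h.1 h.2)
    (fun x => (aWeight q x.1 : ℂ)) (fun x => by
      rw [Complex.norm_real, aWeight, Real.norm_of_nonneg (Real.sqrt_nonneg _)]
      refine Real.sqrt_le_one.2 ?_
      have : 0 ≤ (q ^ 2) ^ (x.1 + 1) := by positivity
      linarith)

/-- The operator representing `γ`. -/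
noncomputable def cOp : RepSpace →L[ℂ] RepSpace :=
  weightedComp id Function.injective_id (fun x : ℕ × ℤ => phase θ ^ x.2 * (q : ℂ) ^ x.1) (fun x => by
    rw [norm_mul, norm_zpow, norm_phase, one_zpow, one_mul, norm_pow, Complex.norm_real]
    exact pow_le_one₀ (norm_nonneg _) (abs_le.2 ⟨hq1.le, hq2.le⟩))

/-- The operator representing `u`. -/
noncomputable def uOp : RepSpace →L[ℂ] RepSpace :=
  weightedComp (fun x : ℕ × ℤ => (x.1, x.2 - 1))
    (fun x y h => by
      simp only [Prod.mk.injEq, sub_left_inj] at h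
      exact Prod.ext h.1 h.2)
    (fun _ => 1) (fun _ => by simp)

theorem aOp_apply (f : RepSpace) (n : ℕ) (k : ℤ) :
    aOp q f (n, k) = aWeight q n * f (n + 1, k) := rfl

theorem star_aOp_apply_zero (f : RepSpace) (k : ℤ) : star (aOp q) f (0, k) = 0 :=
  star_weightedComp_apply_of_notMem _ _ _ _ f fun j h => by simp at h

theorem star_aOp_apply_succ (f : RepSpace) (n : ℕ) (k : ℤ) :
    star (aOp q) f (n + 1, k) = aWeight q n * f (n, k) := by
  refine (star_weightedComp_apply _ _ _ _ f (n, k)).trans ?_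
  rw [Complex.conj_ofReal]

theorem cOp_apply (f : RepSpace) (n : ℕ) (k : ℤ) :
    cOp q θ hq1 hq2 f (n, k) = phase θ ^ k * (q : ℂ) ^ n * f (n, k) := rfl

theorem star_cOp_apply (f : RepSpace) (n : ℕ) (k : ℤ) :
    star (cOp q θ hq1 hq2) f (n, k) = (phase θ ^ k)⁻¹ * (q : ℂ) ^ n * f (n, k) := by
  refine (star_weightedComp_apply _ _ _ _ f (n, k)).trans ?_
  rw [map_mul, map_zpow₀, phase_conj, map_pow, Complex.conj_ofReal, inv_zpow]

theorem uOp_apply (f : RepSpace) (n : ℕ) (k : ℤ) : uOp f (n, k) = f (n, k - 1) :=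
  one_mul _

theorem star_uOp_apply (f : RepSpace) (n : ℕ) (k : ℤ) : star uOp f (n, k) = f (n, k + 1) := by
  have h : star uOp f (n, k + 1 - 1) = conj (1 : ℂ) * f (n, k + 1) :=
    star_weightedComp_apply _ _ _ _ f (n, k + 1)
  rwa [add_sub_cancel_right, map_one, one_mul] at h

/-- The images of the generators in the representation on `ℓ²(ℕ × ℤ)`. -/
noncomputable def repGen : Gen → (RepSpace →L[ℂ] RepSpace)
  | .a => aOp q | .aStar => star (aOp q)
  | .c => cOp q θ hq1 hq2 | .cStar => star (cOp q θ hq1 hq2)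
  | .u => uOp | .uStar => star uOp

theorem star_repGen (g : Gen) : star (repGen q θ hq1 hq2 g) = repGen q θ hq1 hq2 (adj g) := by
  cases g <;> simp [repGen, adj]

/-- All relations are checked coordinatewise. The coordinate n = 0 is separate because the image of
α* vanishes there, in accordance with 1 - q^(2n) = 0. The shift u in k against the weight exp(2πiθk)
of γ gives the covariance relation. -/
theorem repGen_rel (x y : FreeAlgebra ℂ Gen) (h : Rel q θ x y) :
    FreeAlgebra.lift ℂ (repGen q θ hq1 hq2) x = FreeAlgebra.lift ℂ (repGen q θ hq1 hq2) y := by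
  have hp : phase θ ≠ 0 := phase_ne
  have hw := aWeight_mul_self q hq1 hq2
  cases h <;>
  · simp only [map_mul, map_add, map_smul, map_one, FreeAlgebra.lift_ι_apply, repGen]
    ext f ⟨n, k⟩
    simp only [add_apply, mul_apply_eq_comp,
      smul_apply, one_apply_eq_self, lp.coeFn_add, Pi.add_apply,
      lp.coeFn_smul, Pi.smul_apply, smul_eq_mul]
    cases n <;>
    simp only [aOp_apply, star_aOp_apply_zero, star_aOp_apply_succ, cOp_apply, star_cOp_apply,
      uOp_apply, star_uOp_apply, phase_conj, zpow_add₀ hp, zpow_one]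
    all_goals
      have hk := zpow_ne_zero k hp
      generalize phase θ ^ k = P at hk ⊢
      try simp only [add_sub_cancel_right, sub_add_cancel, zero_add, ← mul_assoc, hw]
      try field_simp
      try ring

/-- The representation on `ℓ²(ℕ × ℤ)`. -/
noncomputable def rep : Pol q θ →⋆ₐ[ℂ] (RepSpace →L[ℂ] RepSpace) where
  toAlgHom := lift (repGen q θ hq1 hq2) (repGen_rel q θ hq1 hq2)
  map_star' x := by
    change lift _ (repGen_rel q θ hq1 hq2) _ = star (lift _ (repGen_rel q θ hq1 hq2) _)
    induction x using induct with
    | hs r =>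
      rw [Algebra.algebraMap_eq_smul_one, star_smul, star_one, map_smul, map_smul, map_one,
        star_smul, star_one]
    | hg g => rw [star_gen, lift_gen, lift_gen, star_repGen]
    | hm x y hx hy => rw [star_mul, map_mul, map_mul, star_mul, hx, hy]
    | ha x y hx hy => rw [star_add, map_add, map_add, star_add, hx, hy]

theorem rep_c_ne_zero : rep q θ hq1 hq2 (gen q θ .c) ≠ 0 := by
  have h1 : rep q θ hq1 hq2 (gen q θ .c) = cOp q θ hq1 hq2 := lift_gen _ _ _
  rw [h1]
  intro h
  -- The weight of γ at (0, 0) is 1.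
  have h2 := congrArg (fun T : RepSpace →L[ℂ] RepSpace => T (lp.single 2 (0, 0) 1) (0, 0)) h
  simp [cOp_apply] at h2

end ConcreteRepresentation

end SUqTheta


/-! ### Uniqueness of the pre-C*-norm -/

namespace SUqTheta

section Uniqueness

variable {q θ : ℝ} {B : Type*} [CStarAlgebra B] (π : Pol q θ →⋆ₐ[ℂ] B)
  (hq : q ≠ 0) (hq1 : -1 < q) (hq2 : q < 1) (hθ : Irrational θ) (hc : π (gen q θ .c) ≠ 0)

/-- The norm induced by a representation with `γ ≠ 0`. -/
noncomputable def inducedNorm : AlgebraNorm ℂ (Pol q θ) where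
  toFun x := ‖π x‖
  map_zero' := by simp
  add_le' x y := by rw [map_add]; exact norm_add_le _ _
  neg' x := by rw [map_neg, norm_neg]
  mul_le' x y := by rw [map_mul]; exact norm_mul_le _ _
  eq_zero_of_map_eq_zero' x hx := eq_zero_of_map_eq_zero π hq hq1 hq2 hθ hc (norm_eq_zero.1 hx)
  smul' r x := by rw [map_smul, norm_smul]

include π hq hq1 hq2 hθ hc

theorem existsUnique_preCStarNorm_of_rep :
    ∃! N : AlgebraNorm ℂ (Pol q θ), DiscreteQuantumGroup.IsPreCStarNorm N := by
  refine ⟨inducedNorm π hq hq1 hq2 hθ hc, fun x => ?_, fun N hN => ?_⟩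
  · change ‖π (star x * x)‖ = ‖π x‖ ^ 2
    rw [map_mul, map_star, CStarRing.norm_star_mul_self, sq]
  · obtain ⟨B', _, π', hπ⟩ := exists_starAlgHom_of_isPreCStarNorm hN
    -- N is a norm and γ ≠ 0 in the algebra, since π does not kill it.
    have hc' : π' (gen q θ .c) ≠ 0 := by
      intro h
      have h0 : N (gen q θ .c) = 0 := by rw [← hπ, h, norm_zero]
      exact hc (by rw [N.eq_zero_of_map_eq_zero' _ h0, map_zero])
    refine DFunLike.ext _ _ fun x => ?_
    rw [← hπ]
    exact le_antisymm (norm_map_le π' π hq hq1 hq2 hθ hc' hc x)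
      (norm_map_le π π' hq hq1 hq2 hθ hc hc' x)

omit π hc in
theorem existsUnique_preCStarNorm :
    ∃! N : AlgebraNorm ℂ (Pol q θ), DiscreteQuantumGroup.IsPreCStarNorm N :=
  existsUnique_preCStarNorm_of_rep (rep q θ hq1 hq2) hq hq1 hq2 hθ (rep_c_ne_zero q θ hq1 hq2)

end Uniqueness

/-! ### Failure of local finiteness -/

section LocalFiniteness

variable {q θ : ℝ} (hq : q ≠ 0)

theorem comul_u_pow (n : ℕ) : Coalgebra.comul (R := ℂ) (gen q θ .u ^ n) =
    (gen q θ .u ^ n) ⊗ₜ[ℂ] (gen q θ .u ^ n) := by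
  rw [Bialgebra.comul_pow, comul_gen, comulGen, Algebra.TensorProduct.tmul_pow]

theorem star_u_pow_mul (n : ℕ) : star (gen q θ .u ^ n) * gen q θ .u ^ n = 1 := by
  rw [star_pow, star_gen, adj]
  exact (Commute.mul_pow (by rw [Commute, SemiconjBy, r_uuStar, r_uStaru]) n).symm.trans
    (by rw [r_uStaru, one_pow])

theorem u_pow_mul_star (n : ℕ) : gen q θ .u ^ n * star (gen q θ .u ^ n) = 1 := by
  rw [star_pow, star_gen, adj]
  exact (Commute.mul_pow (by rw [Commute, SemiconjBy, r_uuStar, r_uStaru]) n).symm.trans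
    (by rw [r_uuStar, one_pow])

/-- The one-dimensional representation `uⁿ`. -/
noncomputable def uPowIrrep (θ : ℝ) (hq : q ≠ 0) (n : ℕ) : (SUqCrossedZ q θ hq).Irrep where
  dim := 1
  dim_pos := one_pos
  mat := Matrix.of fun _ _ => (gen q θ .u ^ n : Pol q θ)
  isUnitaryCorep := by
    let := hopf θ hq
    refine ⟨fun i j => ?_, ?_, ?_⟩
    · rw [Fin.sum_univ_one]
      exact comul_u_pow n
    · ext i j
      fin_cases i; fin_cases j
      simp only [Matrix.mul_apply, Fin.sum_univ_one, Matrix.conjTranspose_apply]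
      exact star_u_pow_mul n
    · ext i j
      fin_cases i; fin_cases j
      simp only [Matrix.mul_apply, Fin.sum_univ_one, Matrix.conjTranspose_apply]
      exact u_pow_mul_star n
  irreducible T _ := ⟨T 0 0, by ext i j; fin_cases i; fin_cases j; simp⟩

/-- The values of the character `α ↦ 1`, `γ ↦ 0`, `u ↦ 2`. -/
noncomputable def charGen : Gen → ℂ
  | .a => 1 | .aStar => 1 | .c => 0 | .cStar => 0 | .u => 2 | .uStar => 2⁻¹

/-- The character `α ↦ 1`, `γ ↦ 0`, `u ↦ 2`. -/
noncomputable def charHom (q θ : ℝ) : Pol q θ →ₐ[ℂ] ℂ :=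
  lift charGen (by
    rintro _ _ (_ | _ | _ | _ | _ | _ | _ | _ | _ | _ | _ | _ | _) <;> simp [charGen, -Complex.coe_smul])

/-- A character need not respect the involution here, so u may be sent to 2, whose powers are
distinct. -/
theorem u_pow_injective : Function.Injective fun n : ℕ => gen q θ .u ^ n := by
  intro m n h
  have h' := congrArg (charHom q θ) h
  simp only [map_pow, charHom, lift_gen, charGen] at h'
  have h2 : (2 : ℕ) ^ m = 2 ^ n := by exact_mod_cast h'
  exact Nat.pow_right_injective le_rfl h2

/-- An intertwiner between one-dimensional representations is an invertible scalar, which cancels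
and leaves equal powers of u. -/
theorem uPowIrrep_cls_injective (θ : ℝ) (hq : q ≠ 0) :
    Function.Injective fun n => (uPowIrrep θ hq n).cls := by
  intro m n h
  obtain ⟨T, S, hTS, -, hT⟩ := Quotient.exact h
  change Matrix (Fin 1) (Fin 1) ℂ at T S
  replace hTS : T * S = (1 : Matrix (Fin 1) (Fin 1) ℂ) := hTS
  replace hTS : T 0 0 * S 0 0 = 1 := by
    have := congrFun (congrFun hTS (0 : Fin 1)) (0 : Fin 1)
    rwa [Matrix.mul_apply, Fin.sum_univ_one] at this
  replace hT : T.map (algebraMap ℂ (Pol q θ)) * (Matrix.of fun _ _ => gen q θ .u ^ m : Matrix (Fin 1) (Fin 1) (Pol q θ)) =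
      (Matrix.of fun _ _ => gen q θ .u ^ n : Matrix (Fin 1) (Fin 1) (Pol q θ)) * T.map (algebraMap ℂ (Pol q θ)) := hT
  have h00 := congrFun (congrFun hT (0 : Fin 1)) (0 : Fin 1)
  simp only [Matrix.mul_apply, Fin.sum_univ_one, Matrix.map_apply, Matrix.of_apply] at h00
  rw [← Algebra.commutes, ← Algebra.smul_def, ← Algebra.smul_def] at h00
  have hT0 : T 0 0 ≠ 0 := left_ne_zero_of_mul_eq_one hTS
  exact u_pow_injective (smul_right_injective _ hT0 h00)

theorem uPow_zero_cls (θ : ℝ) (hq : q ≠ 0) :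
    (uPowIrrep θ hq 0).cls = (SUqCrossedZ q θ hq).trivialIrrep.cls := by
  have h : (Matrix.of fun _ _ : Fin 1 => gen q θ .u ^ 0) = 1 := by
    ext i j
    fin_cases i; fin_cases j
    simp
  refine Quotient.sound ?_
  let := hopf θ hq
  change CorepEquiv (Matrix.of fun _ _ : Fin 1 => gen q θ .u ^ 0) (1 : Matrix (Fin 1) (Fin 1) _)
  rw [h]
  exact .refl _

theorem isComponent_uPow (θ : ℝ) (hq : q ≠ 0) (n : ℕ) :
    CompactQuantumGroup.IsComponent (uPowIrrep θ hq n).cls (uPowIrrep θ hq 1).cls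
      (uPowIrrep θ hq (n + 1)).cls := by
  refine ⟨_, _, _, rfl, rfl, rfl, Matrix.of fun _ _ => 1, ?_, ?_⟩
  · intro h
    exact one_ne_zero (congrFun (congrFun h ((0 : Fin 1), (0 : Fin 1))) (0 : Fin 1))
  · let M : Matrix (Fin 1 × Fin 1) (Fin 1) (Pol q θ) :=
      Matrix.map (Matrix.of fun _ _ => (1 : ℂ)) (algebraMap ℂ (Pol q θ))
    change M * (Matrix.of fun _ _ => gen q θ .u ^ (n + 1) : Matrix (Fin 1) (Fin 1) (Pol q θ)) =
      (Matrix.of fun _ _ => gen q θ .u ^ n * gen q θ .u ^ 1 :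
        Matrix (Fin 1 × Fin 1) (Fin 1 × Fin 1) (Pol q θ)) * M
    refine Matrix.ext fun i j => ?_
    simp [M, Matrix.mul_apply, pow_succ]

/-- The single class of u already generates all classes of u^n, by repeated tensoring with u. -/
theorem not_isLocallyFinite (θ : ℝ) (hq : q ≠ 0) : ¬ (SUqCrossedZ q θ hq).dual.IsLocallyFinite := by
  intro h
  have h1 := h {(uPowIrrep θ hq 1).cls} (Set.finite_singleton _)
  refine Set.infinite_range_of_injective (uPowIrrep_cls_injective θ hq) (h1.subset ?_)
  rintro _ ⟨n, rfl⟩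
  induction n with
  | zero =>
    have h0 : CompactQuantumGroup.FusionGenerated {(uPowIrrep θ hq 1).cls}
        (uPowIrrep θ hq 0).cls := by
      rw [uPow_zero_cls]
      exact .trivial
    exact h0
  | succ n ih => exact .tensor _ _ _ ih (.of _ rfl) (isComponent_uPow θ hq n)

end LocalFiniteness

end SUqTheta

theorem theorem4p7 (q θ : ℝ) (hq_lower : -1 < q) (hq_upper : q < 1) (hq : q ≠ 0)
    (hθ : Irrational θ) :
    (SUqCrossedZ q θ hq).dual.IsCStarUnique ∧ ¬ (SUqCrossedZ q θ hq).dual.IsLocallyFinite :=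
  ⟨SUqTheta.existsUnique_preCStarNorm hq hq_lower hq_upper hθ, SUqTheta.not_isLocallyFinite θ hq⟩
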